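/- Let $\mathcal X,\mathcal Y$ be measurable spaces, $\mathcal Z=\mathcal X\times\mathcal Y$, and let $k_{\mathcal X}$, $k_{\mathcal Y}$ be jointly measurable, symmetric, positive (semi)definite real kernels on $\mathcal X$ and $\mathcal Y$. For a probability measure $P$ on $\mathcal Z$ put, with $(X,Y),(X',Y')$ independent of law $P$, $$\mathrm{HSIC}(P)=E\big[k_{\mathcal X}(X,X')k_{\mathcal Y}(Y,Y')\big]+E\big[k_{\mathcal X}(X,X')\big]E\big[k_{\mathcal Y}(Y,Y')\big]-2E_{XY}\big[E_{X'}k_{\mathcal X}(X,X')\,E_{Y'}k_{\mathcal Y}(Y,Y')\big],$$ and for points $z_i=(x_i,y_i)$, $i=1,\dots,n$, let $$\mathrm{HSIC}_{obs}(z_1,\dots,z_n)=\frac1{n^2}\sum_{i,j}k_{\mathcal X}(x_i,x_j)k_{\mathcal Y}(y_i,y_j)+\frac1{n^4}\sum_{i,j,q,r}k_{\mathcal X}(x_i,x_j)k_{\mathcal Y}(y_q,y_r)-\frac2{n^3}\sum_{i,j,q}k_{\mathcal X}(x_i,x_j)k_{\mathcal Y}(y_i,y_q)$$ be the classical empirical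 (V-statistic) estimate. Let $Z_i=(X_i,Y_i)$, $i\ge1$, be i.i.d. with law $P_{XY}$ on $\mathcal Z$, where $\sqrt{k_{\mathcal X}(x,x)}$, $\sqrt{k_{\mathcal Y}(y,y)}$ and $\sqrt{k_{\mathcal X}(x,x)k_{\mathcal Y}(y,y)}$ are $P_{XY}$-integrable. Let $s>0$ and let $\nu^*$ be a probability measure on $\mathcal Z$ for which $k_{\mathcal X}(x,x)$, $k_{\mathcal Y}(y,y)$ and $k_{\mathcal X}(x,x)k_{\mathcal Y}(y,y)$ are integrable. (All these conditions hold for bounded kernels.) Let $Dp(s,\nu^*)$ be the Dirichlet process with base measure $s\nu^*$, i.e. the law of a random probability measure $P_0$ on $\mathcal Z$ such that $(P_0(B_1),\dots,P_0(B_m))\sim \mathrm{Dir}(s\nu^*(B_1),\dots,s\nu^*(B_m))$ for every finite measurable partition $B_1,\dots,B_m$ of $\mathcal Z$. Given $Z_1,\dots,Z_n$, the posterior is the law of the random measure $$P=w_0P_0+\sum_{i=1}^n w_i\delta_{Z_i},\qquad (w_0,\dots,w_n)\sim \mathrm{Dir}(s,1,\dots,1)\ \text{ independent of }\ P_0\sim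 Dp(s,\nu^*),$$ and the Bayesian estimate is the random variable $\widehat{\mathrm{HSIC}}_n=\mathrm{HSIC}(P)$ under this posterior. The limiting case $s=0$ is included: there $w_0=0$ and $(w_1,\dots,w_n)\sim\mathrm{Dir}(1,\dots,1)$, and no prior component is present. Then, for almost every sequence $(Z_i)_{i\ge1}$: 1. the posterior mean $\mathcal E[\widehat{\mathrm{HSIC}}_n]$ exists (the variable is integrable under the posterior) for every $n$; 2. $\mathrm{HSIC}_{obs}(Z_1,\dots,Z_n)\to \mathrm{HSIC}(P_{XY})$ as $n\to\infty$; 3. $\mathcal E[\widehat{\mathrm{HSIC}}_n]\to\mathrm{HSIC}(P_{XY})$ as $n\to\infty$, i.e. the posterior mean has the same limit as the empirical estimate; 4. (asymptotic consistency) for every $\varepsilon>0$ the posterior probability of $|\widehat{\mathrm{HSIC}}_n-\mathrm{HSIC}(P_{XY})|\ge\varepsilon$ tends to $0$ as $n\to\infty$. -/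

import Mathlib

open MeasureTheory ProbabilityTheory Filter
open scoped Topology

noncomputable section

namespace BayesHSIC

/-- A measurable (real-valued, symmetric, positive definite) kernel: all Gram matrices of `k` are
symmetric and positive semidefinite, and `k` is jointly measurable. -/
structure IsMeasurableKernel {S : Type*} [MeasurableSpace S] (k : S → S → ℝ) : Prop where
  posSemidef : (Matrix.of k).PosSemidef
  measurable : Measurable (Function.uncurry k)

/-- The Gamma distribution with shape `a` and rate `1`; for `a = 0` it is the point mass at `0`. -/
def gammaLaw (a : ℝ) : Measure ℝ :=
  if a = 0 then Measure.dirac 0 else gammaMeasure a 1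

/-- The Dirichlet distribution with parameters `α i ≥ 0`, not all zero: the law of
`(G i / ∑ j, G j)` for independent `G i ∼ Gamma (α i, 1)`. Coordinates with `α i = 0` vanish. -/
def dirichletLaw {ι : Type*} [Fintype ι] (α : ι → ℝ) : Measure (ι → ℝ) :=
  (Measure.pi fun i => gammaLaw (α i)).map fun g i => g i / ∑ j, g j

/-- `Q`, a probability law on the probability measures on `S`, is the Dirichlet process with base
measure `ν`: for every finite measurable partition `B 0, …, B (m - 1)` of `S`, the vector of the
`P (B i)` with `P ∼ Q` is Dirichlet distributed with parameters `ν (B i)`. -/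
structure IsDirichletProcess {S : Type*} [MeasurableSpace S] (ν : Measure S)
    (Q : Measure (Measure S)) : Prop where
  isProbabilityMeasure : IsProbabilityMeasure Q
  ae_isProbabilityMeasure : ∀ᵐ P ∂Q, IsProbabilityMeasure P
  map_partition : ∀ (m : ℕ) (B : Fin m → Set S), (∀ i, MeasurableSet (B i)) →
    Pairwise (Function.onFun Disjoint B) → ⋃ i, B i = Set.univ →
    Q.map (fun P i => (P (B i)).toReal) = dirichletLaw fun i => (ν (B i)).toReal

/-- The random measure `w 0 • P₀ + ∑ i, w (i + 1) • δ_{z i}`. -/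
def mixture {S : Type*} [MeasurableSpace S] {n : ℕ} (z : Fin n → S) (w : Fin (n + 1) → ℝ)
    (P₀ : Measure S) : Measure S :=
  ENNReal.ofReal (w 0) • P₀ + ∑ i : Fin n, ENNReal.ofReal (w i.succ) • Measure.dirac (z i)

/-- The posterior law given the observations `z 0, …, z (n - 1)`: the law of
`w 0 • P₀ + ∑ i, w (i + 1) • δ_{z i}`, where `w ∼ Dir (s, 1, …, 1)` and `P₀ ∼ Q` are
independent. For `s = 0` one has `w 0 = 0` almost surely, so that `Q` plays no role. -/
def posterior {S : Type*} [MeasurableSpace S] (s : ℝ) (Q : Measure (Measure S)) {n : ℕ}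
    (z : Fin n → S) : Measure (Measure S) :=
  ((dirichletLaw (Fin.cons s (fun _ => 1) : Fin (n + 1) → ℝ)).prod Q).map
    fun p => mixture z p.1 p.2

section HSIC

variable {𝒳 𝒴 : Type*} [MeasurableSpace 𝒳] [MeasurableSpace 𝒴]

/-- The Hilbert-Schmidt independence criterion of `(X, Y) ∼ P`. -/
def hsic (kX : 𝒳 → 𝒳 → ℝ) (kY : 𝒴 → 𝒴 → ℝ) (P : Measure (𝒳 × 𝒴)) : ℝ :=
  (∫ p, kX p.1.1 p.2.1 * kY p.1.2 p.2.2 ∂(P.prod P))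
    + (∫ p, kX p.1.1 p.2.1 ∂(P.prod P)) * (∫ p, kY p.1.2 p.2.2 ∂(P.prod P))
    - 2 * ∫ z, (∫ z', kX z.1 z'.1 ∂P) * (∫ z', kY z.2 z'.2 ∂P) ∂P

/-- The classical empirical (V-statistic) estimate of the criterion. -/
def hsicObs (kX : 𝒳 → 𝒳 → ℝ) (kY : 𝒴 → 𝒴 → ℝ) {n : ℕ} (z : Fin n → 𝒳 × 𝒴) : ℝ :=
  1 / (n : ℝ) ^ 2 * ∑ i, ∑ j, kX (z i).1 (z j).1 * kY (z i).2 (z j).2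
    + 1 / (n : ℝ) ^ 4 * ∑ i, ∑ j, ∑ q, ∑ r, kX (z i).1 (z j).1 * kY (z q).2 (z r).2
    - 2 / (n : ℝ) ^ 3 * ∑ i, ∑ j, ∑ q, kX (z i).1 (z j).1 * kY (z i).2 (z q).2

end HSIC

end BayesHSIC

end

/-!
If `φ` and `ψ` are feature maps of the two kernels, then `hsic kX kY M = ‖u - a ⊗ b‖ ^ 2`, where `a`
and `b` are the means of `φ` and `ψ` under `M` and `u` is the mean of `φ ⊗ ψ`; the empirical
estimate has the same form with sample averages. The means of a mixture `w₀ P₀ + ∑ wᵢ δ_{zᵢ}` are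
linear in the weights, so the second moments of `Dir (s, 1, …, 1)` bound the posterior expectation
of `‖∑ wᵢ (φ zᵢ - a)‖ ^ 2` by a multiple of `‖average‖ ^ 2 + n⁻² ∑ ‖φ zᵢ - a‖ ^ 2`. Both terms
tend to zero when the features are merely integrable: the first by the strong law of large numbers
in a Hilbert space, the second because the averages of the norms converge. The error in `a ⊗ b`
also contains the product of the two perturbations, whose square is controlled by interpolation
with bounded sixth moments.

What remains is the prior component, which enters through the second moments of the random means
under `Dp (s, ν)`. They are finite because
`E [∫ f dP₀ * ∫ g dP₀] ≤ ∫ f g dν + ∫ f dν * ∫ g dν` for `f, g ≥ 0`, and only this property of the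
prior is used. Altogether `hsic` converges to its population value in `L¹` of the posterior, which
gives the posterior mean and, by Markov's inequality, consistency.
-/

noncomputable section

namespace BayesHSIC

open scoped TensorProduct

universe u v

section HilbertTensor

variable {H H' : Type*} [NormedAddCommGroup H] [InnerProductSpace ℝ H] [NormedAddCommGroup H']
  [InnerProductSpace ℝ H']

/-- The Hilbert space tensor product: the completion of the algebraic tensor product, which
contains the joint feature `φ ⊗ ψ` and its means. -/
abbrev HilbertTensor (H H' : Type*) [NormedAddCommGroup H] [InnerProductSpace ℝ H]
    [NormedAddCommGroup H'] [InnerProductSpace ℝ H'] : Type _ :=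
  UniformSpace.Completion (H ⊗[ℝ] H')

/-- The elementary tensor `a ⊗ b` as an element of the Hilbert space tensor product. -/
def pureTensor (a : H) (b : H') : HilbertTensor H H' :=
  ((a ⊗ₜ[ℝ] b : H ⊗[ℝ] H') : HilbertTensor H H')

theorem norm_pureTensor (a : H) (b : H') : ‖pureTensor a b‖ = ‖a‖ * ‖b‖ := by
  simp [pureTensor]

theorem inner_pureTensor (a a' : H) (b b' : H') :
    inner ℝ (pureTensor a b) (pureTensor a' b') = inner ℝ a a' * inner ℝ b b' := by
  simp [pureTensor]

theorem pureTensor_sub_left (a a' : H) (b : H') :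
    pureTensor (a - a') b = pureTensor a b - pureTensor a' b := by
  simp only [pureTensor, TensorProduct.sub_tmul, UniformSpace.Completion.coe_sub]

theorem pureTensor_sub_right (a : H) (b b' : H') :
    pureTensor a (b - b') = pureTensor a b - pureTensor a b' := by
  simp only [pureTensor, TensorProduct.tmul_sub, UniformSpace.Completion.coe_sub]

end HilbertTensor

section Feature

variable {S H H' : Type*} [MeasurableSpace S]
  [NormedAddCommGroup H] [InnerProductSpace ℝ H] [NormedAddCommGroup H'] [InnerProductSpace ℝ H']
  {φ : S → H} {ψ : S → H'}

/-- A feature map of the kernel `⟪φ x, φ y⟫`, as a map into a possibly nonseparable Hilbert space: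
only weak measurability is required, together with joint measurability of the kernel. -/
structure IsFeature (φ : S → H) : Prop where
  measurable_inner : ∀ f, Measurable fun z => inner ℝ (φ z) f
  measurable_kernel : Measurable fun p : S × S => inner ℝ (φ p.1) (φ p.2)

theorem IsFeature.measurable_norm (hφ : IsFeature φ) : Measurable fun z => ‖φ z‖ := by
  simp_rw [@norm_eq_sqrt_real_inner H]
  exact (hφ.measurable_kernel.comp (measurable_id.prodMk measurable_id)).sqrt

theorem IsFeature.comp {T : Type*} [MeasurableSpace T] (hφ : IsFeature φ) {g : T → S}
    (hg : Measurable g) : IsFeature (φ ∘ g) where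
  measurable_inner f := (hφ.measurable_inner f).comp hg
  measurable_kernel :=
    hφ.measurable_kernel.comp ((hg.comp measurable_fst).prodMk (hg.comp measurable_snd))

theorem IsFeature.sub_const (hφ : IsFeature φ) (m : H) : IsFeature fun z => φ z - m where
  measurable_inner f := by
    simp_rw [inner_sub_left]
    exact (hφ.measurable_inner f).sub_const _
  measurable_kernel := by
    simp_rw [inner_sub_left, inner_sub_right, real_inner_comm (φ _) m]
    exact (hφ.measurable_kernel.sub ((hφ.measurable_inner m).comp measurable_fst)).sub
      (((hφ.measurable_inner m).comp measurable_snd).sub_const _)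

theorem IsFeature.indicator (hφ : IsFeature φ) {A : Set S} (hA : MeasurableSet A) :
    IsFeature (A.indicator φ) where
  measurable_inner f := by
    convert (hφ.measurable_inner f).indicator hA using 2 with z
    by_cases hz : z ∈ A <;> simp [hz]
  measurable_kernel := by
    convert hφ.measurable_kernel.indicator (hA.prod hA) using 2 with p
    by_cases h1 : p.1 ∈ A <;> by_cases h2 : p.2 ∈ A <;> simp [h1, h2]

theorem isClosed_setOf_measurable_inner (φ : S → H) :
    IsClosed {f | Measurable fun z => inner ℝ (φ z) f} := by
  refine IsSeqClosed.isClosed fun u f hu hlim => ?_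
  exact measurable_of_tendsto_metrizable hu
    (tendsto_pi_nhds.2 fun z => tendsto_const_nhds.inner hlim)

theorem IsFeature.tmul (hφ : IsFeature φ) (hψ : IsFeature ψ) :
    IsFeature fun z => pureTensor (φ z) (ψ z) where
  measurable_inner f := by
    refine UniformSpace.Completion.induction_on f (isClosed_setOf_measurable_inner _) fun t => ?_
    induction t using TensorProduct.induction_on with
    | zero => simp [UniformSpace.Completion.coe_zero]
    | tmul a b =>
      change Measurable fun z => inner ℝ (pureTensor (φ z) (ψ z)) (pureTensor a b)
      simp_rw [inner_pureTensor]
      exact (hφ.measurable_inner a).mul (hψ.measurable_inner b)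
    | add t t' ht ht' =>
      simp_rw [UniformSpace.Completion.coe_add, inner_add_right]
      exact ht.add ht'
  measurable_kernel := by
    simp_rw [inner_pureTensor]
    exact hφ.measurable_kernel.mul hψ.measurable_kernel

theorem IsFeature.integrable_inner (hφ : IsFeature φ) {M : Measure S}
    (hM : Integrable (fun z => ‖φ z‖) M) (f : H) : Integrable (fun z => inner ℝ (φ z) f) M :=
  (hM.mul_const ‖f‖).mono' (hφ.measurable_inner f).aestronglyMeasurable
    (ae_of_all _ fun _ => norm_inner_le_norm _ _)

theorem IsFeature.integrable_kernel (hφ : IsFeature φ) {M : Measure S}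
    (hM : Integrable (fun z => ‖φ z‖) M) :
    Integrable (fun p : S × S => inner ℝ (φ p.1) (φ p.2)) (M.prod M) :=
  (hM.mul_prod hM).mono' hφ.measurable_kernel.aestronglyMeasurable
    (ae_of_all _ fun _ => norm_inner_le_norm _ _)

end Feature

section Kernel

variable {S : Type u} {k : S → S → ℝ}

/-- The kernel `k` with values regarded as operators on `ℝ`, which is the form in which kernels
enter the theory of vector valued reproducing kernel Hilbert spaces. -/
def operatorKernel (k : S → S → ℝ) : Matrix S S (ℝ →L[ℝ] ℝ) :=
  .of fun x y => k x y • (1 : ℝ →L[ℝ] ℝ)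

theorem posSemidef_operatorKernel (hk : (Matrix.of k).PosSemidef) :
    (operatorKernel k).PosSemidef := by
  have symm (x y : S) : k y x = k x y := by simpa using hk.isHermitian.apply x y
  refine ((RKHS.posSemidef_tfae (K := operatorKernel k)).out 0 2).2 (And.intro ?_ fun v => ?_)
  · ext x y
    simp [operatorKernel, Matrix.conjTranspose_apply, symm]
  · refine (hk.2 v).trans_eq ?_
    simp only [operatorKernel, Matrix.of_apply, star_trivial, RCLike.re_to_real]
    refine Finsupp.sum_congr fun x _ => Finsupp.sum_congr fun y _ => ?_
    simp only [symm x y, _root_.smul_apply, one_apply_eq_self,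
      smul_eq_mul, RCLike.inner_apply, conj_trivial]
    ring

theorem exists_inner_eq_and_dense_span (hk : (Matrix.of k).PosSemidef) :
    ∃ (H : Type u) (_ : NormedAddCommGroup H) (_ : InnerProductSpace ℝ H) (_ : CompleteSpace H)
      (φ : S → H), (∀ x y, inner ℝ (φ x) (φ y) = k x y) ∧
        Dense (Submodule.span ℝ (Set.range φ) : Set H) := by
  have : Fact (operatorKernel k).PosSemidef := ⟨posSemidef_operatorKernel hk⟩
  let H := RKHS.OfKernel (operatorKernel k)
  refine ⟨H, inferInstance, inferInstance, inferInstance, fun x => RKHS.kerFun H x (1 : ℝ),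
    fun x y => ?_, ?_⟩
  · rw [RKHS.kerFun_inner, RKHS.kerFun_apply, RKHS.OfKernel.kernel_ofKernel]
    simp [operatorKernel]
  · refine (Submodule.dense_iff_topologicalClosure_eq_top.2 (RKHS.kerFun_dense (H := H))).mono
      (Submodule.span_le.2 ?_)
    rintro _ ⟨x, v, rfl⟩
    have : RKHS.kerFun H x v = v • RKHS.kerFun H x (1 : ℝ) := by
      rw [← map_smul, smul_eq_mul, mul_one]
    exact this ▸ Submodule.smul_mem _ v (Submodule.subset_span ⟨x, rfl⟩)

theorem IsMeasurableKernel.exists_isFeature [MeasurableSpace S] (hk : IsMeasurableKernel k) :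
    ∃ (H : Type u) (_ : NormedAddCommGroup H) (_ : InnerProductSpace ℝ H) (_ : CompleteSpace H)
      (φ : S → H), IsFeature φ ∧ ∀ x y, inner ℝ (φ x) (φ y) = k x y := by
  obtain ⟨H, _, _, _, φ, hφ, hdense⟩ := exists_inner_eq_and_dense_span hk.posSemidef
  refine ⟨H, inferInstance, inferInstance, inferInstance, φ, ⟨fun f => ?_, ?_⟩, hφ⟩
  · refine hdense.induction (fun g hg => ?_) (isClosed_setOf_measurable_inner φ) f
    induction hg using Submodule.span_induction with
    | mem g hg =>
      obtain ⟨y, rfl⟩ := hg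
      simp_rw [hφ]
      exact hk.measurable.comp (measurable_id.prodMk measurable_const)
    | zero => simp
    | add g g' _ _ h h' =>
      simp_rw [inner_add_right]
      exact h.add h'
    | smul c g _ h =>
      simp_rw [real_inner_smul_right]
      exact h.const_mul c
  · simp_rw [hφ]
    exact hk.measurable

end Kernel

section Mean

variable {S H H' : Type*} [MeasurableSpace S]
  [NormedAddCommGroup H] [InnerProductSpace ℝ H] [NormedAddCommGroup H'] [InnerProductSpace ℝ H']
  {φ : S → H} {ψ : S → H'} {M : Measure S} {m : H}

/-- `φ` has integrable norm and `m` is its weak (Pettis) mean under `M`: the kernel mean embedding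
of `M` if `φ` is a feature map. The weak notion avoids strong measurability of `φ`, which may fail
in nonseparable spaces. -/
structure HasMean (φ : S → H) (M : Measure S) (m : H) : Prop where
  integrable_norm : Integrable (fun z => ‖φ z‖) M
  integrable_inner : ∀ f, Integrable (fun z => inner ℝ (φ z) f) M
  integral_eq : ∀ f, ∫ z, inner ℝ (φ z) f ∂M = inner ℝ m f

theorem IsFeature.exists_hasMean [CompleteSpace H] (hφ : IsFeature φ)
    (hM : Integrable (fun z => ‖φ z‖) M) : ∃ m, HasMean φ M m := by
  let ℓ : H →ₗ[ℝ] ℝ :=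
    { toFun := fun f => ∫ z, inner ℝ (φ z) f ∂M
      map_add' := fun f g => by
        simp_rw [inner_add_right]
        exact integral_add (hφ.integrable_inner hM f) (hφ.integrable_inner hM g)
      map_smul' := fun c f => by
        simp_rw [real_inner_smul_right, integral_const_mul]
        rfl }
  let L : StrongDual ℝ H := ℓ.mkContinuous (∫ z, ‖φ z‖ ∂M) fun f => by
    rw [← integral_mul_const]
    exact (norm_integral_le_integral_norm _).trans (integral_mono
      (hφ.integrable_inner hM f).norm (hM.mul_const _) fun z => norm_inner_le_norm _ _)
  refine ⟨(InnerProductSpace.toDual ℝ H).symm L, hM, hφ.integrable_inner hM, fun f => ?_⟩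
  rw [InnerProductSpace.toDual_symm_apply]
  rfl

theorem HasMean.norm_le (hm : HasMean φ M m) : ‖m‖ ≤ ∫ z, ‖φ z‖ ∂M := by
  rcases eq_or_ne m 0 with rfl | hm0
  · simpa using integral_nonneg fun z => norm_nonneg (φ z)
  refine le_of_mul_le_mul_right ?_ (norm_pos_iff.2 hm0)
  rw [← real_inner_self_eq_norm_mul_norm, ← hm.integral_eq, ← integral_mul_const]
  exact integral_mono (hm.integrable_inner m) (hm.integrable_norm.mul_const _)
    fun z => real_inner_le_norm _ _

theorem HasMean.sub {χ : S → H} {m' : H} (h : HasMean φ M m) (h' : HasMean χ M m')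
    (hsub : IsFeature fun z => φ z - χ z) : HasMean (fun z => φ z - χ z) M (m - m') where
  integrable_norm := (h.integrable_norm.add h'.integrable_norm).mono'
    hsub.measurable_norm.aestronglyMeasurable
    (ae_of_all _ fun z => (norm_norm (φ z - χ z)).trans_le (norm_sub_le _ _))
  integrable_inner f := by
    simp_rw [inner_sub_left]
    exact (h.integrable_inner f).sub (h'.integrable_inner f)
  integral_eq f := by
    simp_rw [inner_sub_left]
    rw [integral_sub (h.integrable_inner f) (h'.integrable_inner f), h.integral_eq, h'.integral_eq]

theorem hasMean_const [IsProbabilityMeasure M] (m : H) : HasMean (fun _ => m) M m where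
  integrable_norm := integrable_const _
  integrable_inner f := integrable_const _
  integral_eq f := by simp

theorem HasMean.add_measure {N : Measure S} {m' : H} (h : HasMean φ M m) (h' : HasMean φ N m') :
    HasMean φ (M + N) (m + m') where
  integrable_norm := h.integrable_norm.add_measure h'.integrable_norm
  integrable_inner f := (h.integrable_inner f).add_measure (h'.integrable_inner f)
  integral_eq f := by
    rw [integral_add_measure (h.integrable_inner f) (h'.integrable_inner f), h.integral_eq,
      h'.integral_eq, inner_add_left]

theorem HasMean.smul_measure (h : HasMean φ M m) {c : ℝ} (hc : 0 ≤ c) :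
    HasMean φ (ENNReal.ofReal c • M) (c • m) where
  integrable_norm := h.integrable_norm.smul_measure ENNReal.ofReal_ne_top
  integrable_inner f := (h.integrable_inner f).smul_measure ENNReal.ofReal_ne_top
  integral_eq f := by
    rw [integral_smul_measure, h.integral_eq, ENNReal.toReal_ofReal hc, real_inner_smul_left,
      smul_eq_mul]

theorem HasMean.sum_measure {ι : Type*} {M : ι → Measure S} {m : ι → H}
    (h : ∀ i, HasMean φ (M i) (m i)) (s : Finset ι) :
    HasMean φ (∑ i ∈ s, M i) (∑ i ∈ s, m i) where
  integrable_norm := integrable_finsetSum_measure.2 fun i _ => (h i).integrable_norm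
  integrable_inner f := integrable_finsetSum_measure.2 fun i _ => (h i).integrable_inner f
  integral_eq f := by
    rw [integral_finsetSum_measure fun i _ => (h i).integrable_inner f, sum_inner]
    exact Finset.sum_congr rfl fun i _ => (h i).integral_eq f

theorem IsFeature.hasMean_dirac (hφ : IsFeature φ) (z : S) :
    HasMean φ (Measure.dirac z) (φ z) where
  integrable_norm := integrable_dirac' hφ.measurable_norm.stronglyMeasurable (by simp)
  integrable_inner f := integrable_dirac' (hφ.measurable_inner f).stronglyMeasurable (by simp)
  integral_eq f := integral_dirac' _ _ (hφ.measurable_inner f).stronglyMeasurable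

theorem IsFeature.hasMean_mixture (hφ : IsFeature φ) {n : ℕ} (z : Fin n → S)
    {w : Fin (n + 1) → ℝ} (hw : ∀ i, 0 ≤ w i) (hm : HasMean φ M m) :
    HasMean φ (mixture z w M) (w 0 • m + ∑ i : Fin n, w i.succ • φ (z i)) :=
  (hm.smul_measure (hw 0)).add_measure
    (HasMean.sum_measure (fun i => (hφ.hasMean_dirac (z i)).smul_measure (hw _)) _)

theorem HasMean.integral_kernel [SFinite M] (hm : HasMean φ M m) (hφ : IsFeature φ) :
    ∫ p, inner ℝ (φ p.1) (φ p.2) ∂(M.prod M) = ‖m‖ ^ 2 := by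
  rw [integral_prod _ (hφ.integrable_kernel hm.integrable_norm), ← real_inner_self_eq_norm_sq,
    ← hm.integral_eq]
  congr 1 with z
  simp_rw [fun z' => real_inner_comm (φ z') (φ z)]
  rw [hm.integral_eq, real_inner_comm]

/-- `a`, `b` and `u` are the means under `M` of the feature maps `φ`, `ψ` and of their joint
feature `φ ⊗ ψ`. -/
structure HasMeans (φ : S → H) (ψ : S → H') (M : Measure S) (a : H) (b : H')
    (u : HilbertTensor H H') : Prop where
  left : HasMean φ M a
  right : HasMean ψ M b
  joint : HasMean (fun z => pureTensor (φ z) (ψ z)) M u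

end Mean

section HSIC

variable {𝒳 𝒴 H H' : Type*} [NormedAddCommGroup H] [InnerProductSpace ℝ H]
  [NormedAddCommGroup H'] [InnerProductSpace ℝ H'] [MeasurableSpace 𝒳] [MeasurableSpace 𝒴]
  {kX : 𝒳 → 𝒳 → ℝ} {kY : 𝒴 → 𝒴 → ℝ} {φ : 𝒳 × 𝒴 → H} {ψ : 𝒳 × 𝒴 → H'}
  {M : Measure (𝒳 × 𝒴)} {a : H} {b : H'} {u : HilbertTensor H H'}

/-- The embedding `u - a ⊗ b` of the cross-covariance of two features with means `a` and `b` and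
joint mean `u`; its squared norm is the independence criterion. -/
def crossCov (a : H) (b : H') (u : HilbertTensor H H') : HilbertTensor H H' :=
  u - pureTensor a b

/-- `φ` and `ψ` are feature maps of the kernels `kX` and `kY`, regarded as functions of the pair
`(x, y)`. -/
structure IsFeaturePair (kX : 𝒳 → 𝒳 → ℝ) (kY : 𝒴 → 𝒴 → ℝ) (φ : 𝒳 × 𝒴 → H)
    (ψ : 𝒳 × 𝒴 → H') : Prop where
  left : IsFeature φ
  right : IsFeature ψ
  inner_left : ∀ z z', inner ℝ (φ z) (φ z') = kX z.1 z'.1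
  inner_right : ∀ z z', inner ℝ (ψ z) (ψ z') = kY z.2 z'.2

theorem exists_isFeaturePair {𝒳 : Type u} {𝒴 : Type v} [MeasurableSpace 𝒳] [MeasurableSpace 𝒴]
    {kX : 𝒳 → 𝒳 → ℝ} {kY : 𝒴 → 𝒴 → ℝ} (hkX : IsMeasurableKernel kX)
    (hkY : IsMeasurableKernel kY) :
    ∃ (H : Type u) (_ : NormedAddCommGroup H) (_ : InnerProductSpace ℝ H) (_ : CompleteSpace H)
      (H' : Type v) (_ : NormedAddCommGroup H') (_ : InnerProductSpace ℝ H') (_ : CompleteSpace H')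
      (φ : 𝒳 × 𝒴 → H) (ψ : 𝒳 × 𝒴 → H'), IsFeaturePair kX kY φ ψ := by
  obtain ⟨H, _, _, _, φ, hφ, hφk⟩ := hkX.exists_isFeature
  obtain ⟨H', _, _, _, ψ, hψ, hψk⟩ := hkY.exists_isFeature
  exact ⟨H, inferInstance, inferInstance, inferInstance, H', inferInstance, inferInstance,
    inferInstance, φ ∘ Prod.fst, ψ ∘ Prod.snd, hφ.comp measurable_fst, hψ.comp measurable_snd,
    fun _ _ => hφk _ _, fun _ _ => hψk _ _⟩

namespace IsFeaturePair

theorem joint (hp : IsFeaturePair kX kY φ ψ) : IsFeature fun z => pureTensor (φ z) (ψ z) :=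
  hp.left.tmul hp.right

theorem measurable_kernel_left (hp : IsFeaturePair kX kY φ ψ) :
    Measurable fun p : (𝒳 × 𝒴) × (𝒳 × 𝒴) => kX p.1.1 p.2.1 := by
  simpa only [hp.inner_left] using hp.left.measurable_kernel

theorem measurable_kernel_right (hp : IsFeaturePair kX kY φ ψ) :
    Measurable fun p : (𝒳 × 𝒴) × (𝒳 × 𝒴) => kY p.1.2 p.2.2 := by
  simpa only [hp.inner_right] using hp.right.measurable_kernel

theorem norm_left (hp : IsFeaturePair kX kY φ ψ) (z : 𝒳 × 𝒴) : ‖φ z‖ = √(kX z.1 z.1) := by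
  rw [norm_eq_sqrt_real_inner, hp.inner_left]

theorem norm_right (hp : IsFeaturePair kX kY φ ψ) (z : 𝒳 × 𝒴) : ‖ψ z‖ = √(kY z.2 z.2) := by
  rw [norm_eq_sqrt_real_inner, hp.inner_right]

theorem norm_joint (hp : IsFeaturePair kX kY φ ψ) (z : 𝒳 × 𝒴) :
    ‖pureTensor (φ z) (ψ z)‖ = √(kX z.1 z.1 * kY z.2 z.2) := by
  rw [norm_eq_sqrt_real_inner, inner_pureTensor, hp.inner_left, hp.inner_right]

theorem exists_hasMeans [CompleteSpace H] [CompleteSpace H'] (hp : IsFeaturePair kX kY φ ψ)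
    (hX : Integrable (fun z => ‖φ z‖) M) (hY : Integrable (fun z => ‖ψ z‖) M)
    (hXY : Integrable (fun z => ‖pureTensor (φ z) (ψ z)‖) M) :
    ∃ a b u, HasMeans φ ψ M a b u := by
  obtain ⟨a, ha⟩ := hp.left.exists_hasMean hX
  obtain ⟨b, hb⟩ := hp.right.exists_hasMean hY
  obtain ⟨u, hu⟩ := hp.joint.exists_hasMean hXY
  exact ⟨a, b, u, ha, hb, hu⟩

theorem integral_kernel_left (hp : IsFeaturePair kX kY φ ψ) (ha : HasMean φ M a) (z : 𝒳 × 𝒴) :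
    ∫ z', kX z.1 z'.1 ∂M = inner ℝ (φ z) a := by
  rw [real_inner_comm, ← ha.integral_eq]
  simp_rw [fun z' => real_inner_comm (φ z) (φ z'), hp.inner_left]

theorem integral_kernel_right (hp : IsFeaturePair kX kY φ ψ) (hb : HasMean ψ M b) (z : 𝒳 × 𝒴) :
    ∫ z', kY z.2 z'.2 ∂M = inner ℝ (ψ z) b := by
  rw [real_inner_comm, ← hb.integral_eq]
  simp_rw [fun z' => real_inner_comm (ψ z) (ψ z'), hp.inner_right]

theorem hsic_eq_norm_sq [SFinite M] (hp : IsFeaturePair kX kY φ ψ) (h : HasMeans φ ψ M a b u) :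
    hsic kX kY M = ‖crossCov a b u‖ ^ 2 := by
  have joint_sq := h.joint.integral_kernel hp.joint
  have left_sq := h.left.integral_kernel hp.left
  have right_sq := h.right.integral_kernel hp.right
  have cross : ∫ z, inner ℝ (φ z) a * inner ℝ (ψ z) b ∂M = inner ℝ u (pureTensor a b) := by
    rw [← h.joint.integral_eq]
    simp_rw [inner_pureTensor]
  simp only [inner_pureTensor, hp.inner_left, hp.inner_right] at joint_sq left_sq right_sq
  simp_rw [hsic, joint_sq, left_sq, right_sq, hp.integral_kernel_left h.left,
    hp.integral_kernel_right h.right, cross, crossCov]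
  rw [norm_sub_sq_real, norm_pureTensor]
  ring

theorem hsicObs_eq_norm_sq (hp : IsFeaturePair kX kY φ ψ) {n : ℕ} (z : Fin n → 𝒳 × 𝒴) :
    hsicObs kX kY z
      = ‖crossCov ((n : ℝ)⁻¹ • ∑ i, φ (z i)) ((n : ℝ)⁻¹ • ∑ i, ψ (z i))
          ((n : ℝ)⁻¹ • ∑ i, pureTensor (φ (z i)) (ψ (z i)))‖ ^ 2 := by
  have left_sq : ‖∑ i, φ (z i)‖ ^ 2 = ∑ i, ∑ j, kX (z i).1 (z j).1 := by
    simp_rw [← real_inner_self_eq_norm_sq, sum_inner, inner_sum, hp.inner_left]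
  have right_sq : ‖∑ i, ψ (z i)‖ ^ 2 = ∑ i, ∑ j, kY (z i).2 (z j).2 := by
    simp_rw [← real_inner_self_eq_norm_sq, sum_inner, inner_sum, hp.inner_right]
  have joint_sq : ‖∑ i, pureTensor (φ (z i)) (ψ (z i))‖ ^ 2
      = ∑ i, ∑ j, kX (z i).1 (z j).1 * kY (z i).2 (z j).2 := by
    simp_rw [← real_inner_self_eq_norm_sq, sum_inner, inner_sum, inner_pureTensor, hp.inner_left,
      hp.inner_right]
  have cross : inner ℝ (∑ i, pureTensor (φ (z i)) (ψ (z i)))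
        (pureTensor ((n : ℝ)⁻¹ • ∑ i, φ (z i)) ((n : ℝ)⁻¹ • ∑ i, ψ (z i)))
      = (n : ℝ)⁻¹ ^ 2 * ∑ i, ∑ j, ∑ q, kX (z i).1 (z j).1 * kY (z i).2 (z q).2 := by
    simp_rw [sum_inner, inner_pureTensor, real_inner_smul_right, inner_sum, hp.inner_left,
      hp.inner_right, ← Finset.sum_mul_sum, Finset.mul_sum _ _ ((n : ℝ)⁻¹ ^ 2)]
    exact Finset.sum_congr rfl fun i _ => by ring
  rw [crossCov, norm_sub_sq_real, real_inner_smul_left, cross, norm_pureTensor]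
  simp_rw [norm_smul, mul_pow, left_sq, right_sq, joint_sq, norm_inv, Real.norm_natCast, hsicObs,
    ← Finset.mul_sum, ← Finset.sum_mul]
  simp only [div_eq_mul_inv, inv_pow]
  ring

end IsFeaturePair

end HSIC

section Gamma

variable {a : ℝ}

theorem ascPochhammer_eval_nonneg (ha : 0 ≤ a) (m : ℕ) : 0 ≤ (ascPochhammer ℝ m).eval a := by
  rcases ha.eq_or_lt with rfl | h
  · rw [ascPochhammer_eval_zero]
    split_ifs <;> norm_num
  · exact (ascPochhammer_pos _ _ h).le

theorem ascPochhammer_eval_le_pow (ha : 0 ≤ a) (m : ℕ) :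
    (ascPochhammer ℝ m).eval a ≤ (a + m) ^ m := by
  induction m with
  | zero => simp
  | succ m ih =>
    rw [ascPochhammer_succ_eval, pow_succ]
    gcongr
    · exact ih.trans (by gcongr; simp)
    · simp

theorem pow_le_ascPochhammer_eval (ha : 0 ≤ a) (m : ℕ) : a ^ m ≤ (ascPochhammer ℝ m).eval a := by
  induction m with
  | zero => simp
  | succ m ih =>
    rw [ascPochhammer_succ_eval, pow_succ]
    gcongr
    · exact ascPochhammer_eval_nonneg ha m
    · simp

theorem gamma_add_natCast (ha : 0 < a) (m : ℕ) :
    Real.Gamma (a + m) = (ascPochhammer ℝ m).eval a * Real.Gamma a := by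
  induction m with
  | zero => simp
  | succ m ih =>
    rw [Nat.cast_succ, ← add_assoc, Real.Gamma_add_one (by positivity), ih,
      ascPochhammer_succ_eval]
    ring

theorem isProbabilityMeasure_gammaLaw (ha : 0 ≤ a) : IsProbabilityMeasure (gammaLaw a) := by
  unfold gammaLaw
  split_ifs with h
  · infer_instance
  · exact isProbabilityMeasure_gammaMeasure (lt_of_le_of_ne' ha h) one_pos

theorem measurable_gammaPDF (a r : ℝ) : Measurable (gammaPDF a r) :=
  (measurable_gammaPDFReal a r).ennreal_ofReal

theorem ae_pos_gammaLaw (ha : 0 < a) : ∀ᵐ g ∂gammaLaw a, 0 < g := by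
  rw [gammaLaw, if_neg ha.ne', gammaMeasure, ae_withDensity_iff (measurable_gammaPDF a 1)]
  filter_upwards [Measure.ae_ne volume (0 : ℝ)] with g hg hpdf
  exact lt_of_le_of_ne' (not_lt.1 fun h => hpdf (gammaPDF_of_neg h)) hg

theorem ae_nonneg_gammaLaw (ha : 0 ≤ a) : ∀ᵐ g ∂gammaLaw a, 0 ≤ g := by
  rcases ha.eq_or_lt with rfl | ha
  · simp [gammaLaw]
  · exact (ae_pos_gammaLaw ha).mono fun g hg => hg.le

theorem gammaPDF_mul_pow_mul_exp (ha : 0 < a) {t g : ℝ} (ht : 0 ≤ t) (hg : 0 < g) (m : ℕ) :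
    gammaPDF a 1 g * ENNReal.ofReal (g ^ m * Real.exp (-(t * g)))
      = ENNReal.ofReal ((ascPochhammer ℝ m).eval a * (1 + t) ^ (-(a + m)))
        * gammaPDF (a + m) (1 + t) g := by
  have ht1 : 0 < 1 + t := by linarith
  have := Real.Gamma_pos_of_pos ha
  have hasc := ascPochhammer_pos m a ha
  rw [gammaPDF_of_nonneg hg.le, gammaPDF_of_nonneg hg.le, ← ENNReal.ofReal_mul (by positivity),
    ← ENNReal.ofReal_mul (by positivity), gamma_add_natCast ha]
  have hpow : g ^ (a + m - 1) = g ^ (a - 1) * g ^ m := by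
    rw [← Real.rpow_natCast, ← Real.rpow_add hg]
    ring_nf
  have hexp : Real.exp (-((1 + t) * g)) = Real.exp (-(1 * g)) * Real.exp (-(t * g)) := by
    rw [← Real.exp_add]
    ring_nf
  have hrate : (1 + t) ^ (a + m) ≠ 0 := (Real.rpow_pos_of_pos ht1 _).ne'
  rw [hpow, hexp, Real.rpow_neg ht1.le, Real.one_rpow]
  field_simp

theorem lintegral_pow_mul_exp_gammaLaw (ha : 0 ≤ a) {t : ℝ} (ht : 0 ≤ t) (m : ℕ) :
    ∫⁻ g, ENNReal.ofReal (g ^ m * Real.exp (-(t * g))) ∂gammaLaw a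
      = ENNReal.ofReal ((ascPochhammer ℝ m).eval a * (1 + t) ^ (-(a + m))) := by
  rcases ha.eq_or_lt with rfl | ha
  · rw [gammaLaw, if_pos rfl, lintegral_dirac' _ (by fun_prop), ascPochhammer_eval_zero]
    rcases eq_or_ne m 0 with rfl | hm
    · simp
    · simp [hm]
  rw [gammaLaw, if_neg ha.ne', gammaMeasure,
    lintegral_withDensity_eq_lintegral_mul _ (measurable_gammaPDF a 1) (by fun_prop),
    ← mul_one (ENNReal.ofReal (_ * _)),
    ← lintegral_gammaPDF_eq_one (show 0 < a + m by positivity) (show 0 < 1 + t by linarith),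
    ← lintegral_const_mul _ (measurable_gammaPDF _ _)]
  refine lintegral_congr_ae ?_
  filter_upwards [Measure.ae_ne volume (0 : ℝ)] with g hg
  rcases hg.lt_or_gt with h | h
  · simp [gammaPDF_of_neg h]
  · exact gammaPDF_mul_pow_mul_exp ha ht h m

theorem lintegral_Ioi_pow_mul_exp {r : ℝ} (hr : 0 < r) (e : ℕ) :
    ∫⁻ t in Set.Ioi (0 : ℝ), ENNReal.ofReal (t ^ e * Real.exp (-(t * r)))
      = ENNReal.ofReal (e.factorial / r ^ (e + 1)) := by
  have hrpow (t : ℝ) : t ^ e * Real.exp (-(t * r))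
      = t ^ ((e + 1 : ℝ) - 1) * Real.exp (-(r * t)) := by
    rw [add_sub_cancel_right, Real.rpow_natCast, mul_comm t r]
  have hint := Real.integral_rpow_mul_exp_neg_mul_Ioi (a := (e : ℝ) + 1) (by positivity) hr
  have hpos : 0 < (1 / r) ^ ((e : ℝ) + 1) * Real.Gamma (e + 1) := by
    have := Real.Gamma_pos_of_pos (s := (e : ℝ) + 1) (by positivity)
    positivity
  simp_rw [hrpow]
  rw [← ofReal_integral_eq_lintegral_ofReal, hint]
  · rw [Real.Gamma_nat_eq_factorial]
    congr 1
    rw [← Nat.cast_succ, Real.rpow_natCast, Nat.succ_eq_add_one, one_div, inv_pow, mul_comm,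
      div_eq_mul_inv]
  · exact not_imp_comm.1 integral_undef (hint ▸ hpos.ne')
  · filter_upwards [self_mem_ae_restrict measurableSet_Ioi] with t ht
    have : (0 : ℝ) < t := ht
    positivity

end Gamma

section Dirichlet

variable {ι : Type*} [Fintype ι] {a : ι → ℝ}

theorem isProbabilityMeasure_pi_gammaLaw (ha : ∀ i, 0 ≤ a i) :
    IsProbabilityMeasure (Measure.pi fun i => gammaLaw (a i)) := by
  have (i : ι) := isProbabilityMeasure_gammaLaw (ha i)
  infer_instance

theorem ae_nonneg_pi_gammaLaw (ha : ∀ i, 0 ≤ a i) :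
    ∀ᵐ g ∂(Measure.pi fun i => gammaLaw (a i)), ∀ i, 0 ≤ g i := by
  have (i : ι) := isProbabilityMeasure_gammaLaw (ha i)
  exact ae_all_iff.2 fun i => Measure.tendsto_eval_ae_ae.eventually (ae_nonneg_gammaLaw (ha i))

theorem ae_sum_pos_pi_gammaLaw (ha : ∀ i, 0 ≤ a i) (hs : 0 < ∑ i, a i) :
    ∀ᵐ g ∂(Measure.pi fun i => gammaLaw (a i)), 0 < ∑ i, g i := by
  have (i : ι) := isProbabilityMeasure_gammaLaw (ha i)
  obtain ⟨j, -, hj⟩ := Finset.exists_lt_of_sum_lt (f := fun _ => (0 : ℝ)) (by simpa using hs)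
  have hgj : ∀ᵐ g ∂(Measure.pi fun i => gammaLaw (a i)), 0 < g j :=
    Measure.tendsto_eval_ae_ae.eventually (ae_pos_gammaLaw hj)
  filter_upwards [ae_nonneg_pi_gammaLaw ha, hgj] with g hg hgj
  exact Finset.sum_pos' (fun i _ => hg i) ⟨j, Finset.mem_univ j, hgj⟩

theorem lintegral_prod_pi {Ω : ι → Type*} [∀ i, MeasurableSpace (Ω i)] (μ : ∀ i, Measure (Ω i))
    [∀ i, IsProbabilityMeasure (μ i)] {f : ∀ i, Ω i → ENNReal} (hf : ∀ i, Measurable (f i)) :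
    ∫⁻ x, ∏ i, f i (x i) ∂Measure.pi μ = ∏ i, ∫⁻ x, f i x ∂μ i := by
  rw [lintegral_prod_eq_prod_lintegral_of_indepFun Finset.univ _
    (iIndepFun_pi fun i => (hf i).aemeasurable) fun i => (hf i).comp (measurable_pi_apply i)]
  exact Finset.prod_congr rfl fun i _ => (measurePreserving_eval μ i).lintegral_comp (hf i)

theorem lintegral_prod_pow_mul_exp_pi_gammaLaw (ha : ∀ i, 0 ≤ a i) {t : ℝ} (ht : 0 ≤ t)
    (m : ι → ℕ) :
    ∫⁻ g, ENNReal.ofReal ((∏ i, g i ^ m i) * Real.exp (-(t * ∑ i, g i)))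
        ∂(Measure.pi fun i => gammaLaw (a i))
      = ENNReal.ofReal ((∏ i, (ascPochhammer ℝ (m i)).eval (a i))
        * (1 + t) ^ (-(∑ i, a i + (∑ i, m i : ℕ)))) := by
  have (i : ι) := isProbabilityMeasure_gammaLaw (ha i)
  have ht1 : 0 < 1 + t := by linarith
  have hasc (i : ι) := ascPochhammer_eval_nonneg (ha i) (m i)
  have factor : ∀ᵐ g ∂(Measure.pi fun i => gammaLaw (a i)),
      ENNReal.ofReal ((∏ i, g i ^ m i) * Real.exp (-(t * ∑ i, g i)))
        = ∏ i, ENNReal.ofReal (g i ^ m i * Real.exp (-(t * g i))) := by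
    filter_upwards [ae_nonneg_pi_gammaLaw ha] with g hg
    rw [← ENNReal.ofReal_prod_of_nonneg fun i _ => mul_nonneg (pow_nonneg (hg i) _)
      (Real.exp_nonneg _), Finset.prod_mul_distrib, ← Real.exp_sum, Finset.sum_neg_distrib,
      Finset.mul_sum]
  rw [lintegral_congr_ae factor, lintegral_prod_pi _ fun i =>
    show Measurable fun x => ENNReal.ofReal (x ^ m i * Real.exp (-(t * x))) by fun_prop]
  simp_rw [lintegral_pow_mul_exp_gammaLaw (ha _) ht]
  rw [← ENNReal.ofReal_prod_of_nonneg fun i _ => mul_nonneg (hasc i) (by positivity),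
    Finset.prod_mul_distrib, ← Real.rpow_sum_of_pos ht1, Finset.sum_neg_distrib,
    Finset.sum_add_distrib, Nat.cast_sum]

theorem measurable_normalize : Measurable fun (g : ι → ℝ) i => g i / ∑ j, g j :=
  measurable_pi_lambda _ fun i => by fun_prop

theorem isProbabilityMeasure_dirichletLaw (ha : ∀ i, 0 ≤ a i) :
    IsProbabilityMeasure (dirichletLaw a) := by
  have := isProbabilityMeasure_pi_gammaLaw ha
  exact Measure.isProbabilityMeasure_map measurable_normalize.aemeasurable

theorem ae_nonneg_dirichletLaw (ha : ∀ i, 0 ≤ a i) : ∀ᵐ w ∂dirichletLaw a, ∀ i, 0 ≤ w i := by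
  rw [dirichletLaw, ae_map_iff measurable_normalize.aemeasurable
    (measurableSet_setOfPred.2 (by fun_prop))]
  filter_upwards [ae_nonneg_pi_gammaLaw ha] with g hg i
  exact div_nonneg (hg i) (Finset.sum_nonneg fun j _ => hg j)

theorem ae_sum_eq_one_dirichletLaw (ha : ∀ i, 0 ≤ a i) (hs : 0 < ∑ i, a i) :
    ∀ᵐ w ∂dirichletLaw a, ∑ i, w i = 1 := by
  rw [dirichletLaw, ae_map_iff measurable_normalize.aemeasurable
    (measurableSet_eq_fun (by fun_prop) measurable_const)]
  filter_upwards [ae_sum_pos_pi_gammaLaw ha hs] with g hg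
  rw [← Finset.sum_div, div_self hg.ne']

theorem ae_sum_le_one_dirichletLaw (a : ι → ℝ) : ∀ᵐ w ∂dirichletLaw a, ∑ i, w i ≤ 1 := by
  rw [dirichletLaw, ae_map_iff measurable_normalize.aemeasurable
    (measurableSet_le (by fun_prop) measurable_const)]
  refine ae_of_all _ fun g => ?_
  rw [← Finset.sum_div]
  exact div_self_le_one _

theorem integrable_dirichletLaw (ha : ∀ i, 0 ≤ a i) {F : (ι → ℝ) → ℝ} (hF : Continuous F) :
    Integrable F (dirichletLaw a) := by
  have := isProbabilityMeasure_dirichletLaw ha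
  have hcube : ∀ᵐ w ∂dirichletLaw a, w ∈ Set.Icc (0 : ι → ℝ) 1 := by
    filter_upwards [ae_nonneg_dirichletLaw ha, ae_sum_le_one_dirichletLaw a] with w hw hw1
    exact ⟨hw, fun i => (Finset.single_le_sum (fun j _ => hw j) (Finset.mem_univ i)).trans hw1⟩
  rw [← Measure.restrict_eq_self_of_ae_mem hcube]
  exact hF.continuousOn.integrableOn_compact isCompact_Icc

theorem ofReal_prod_normalize_pow {g : ι → ℝ} (hg : ∀ i, 0 ≤ g i) (hs : 0 < ∑ i, g i)
    {m : ι → ℕ} {e : ℕ} (hm : ∑ i, m i = e + 1) :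
    ENNReal.ofReal (∏ i, (g i / ∑ j, g j) ^ m i)
      = ∫⁻ t in Set.Ioi (0 : ℝ), ENNReal.ofReal ((e.factorial : ℝ)⁻¹ * t ^ e)
          * ENNReal.ofReal ((∏ i, g i ^ m i) * Real.exp (-(t * ∑ i, g i))) := by
  have hprod : 0 ≤ ∏ i, g i ^ m i := Finset.prod_nonneg fun i _ => pow_nonneg (hg i) _
  have factor (t : ℝ) (ht : t ∈ Set.Ioi (0 : ℝ)) :
      ENNReal.ofReal ((e.factorial : ℝ)⁻¹ * t ^ e)
          * ENNReal.ofReal ((∏ i, g i ^ m i) * Real.exp (-(t * ∑ i, g i)))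
        = ENNReal.ofReal ((e.factorial : ℝ)⁻¹ * ∏ i, g i ^ m i)
          * ENNReal.ofReal (t ^ e * Real.exp (-(t * ∑ i, g i))) := by
    have : 0 < t := ht
    rw [← ENNReal.ofReal_mul (by positivity), ← ENNReal.ofReal_mul (by positivity)]
    ring_nf
  rw [setLIntegral_congr_fun measurableSet_Ioi factor, lintegral_const_mul _ (by fun_prop),
    lintegral_Ioi_pow_mul_exp hs, ← ENNReal.ofReal_mul (by positivity)]
  simp_rw [div_pow]
  rw [Finset.prod_div_distrib, Finset.prod_pow_eq_pow_sum, hm]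
  have := e.factorial_ne_zero
  congr 1
  field_simp

theorem lintegral_prod_pow_dirichletLaw (ha : ∀ i, 0 ≤ a i) (hs : 0 < ∑ i, a i) (m : ι → ℕ)
    {e : ℕ} (hm : ∑ i, m i = e + 1) :
    ∫⁻ w, ENNReal.ofReal (∏ i, w i ^ m i) ∂dirichletLaw a
      = ENNReal.ofReal (∏ i, (ascPochhammer ℝ (m i)).eval (a i))
        * ∫⁻ t in Set.Ioi (0 : ℝ), ENNReal.ofReal
          ((e.factorial : ℝ)⁻¹ * t ^ e * (1 + t) ^ (-(∑ i, a i + (e + 1 : ℕ)))) := by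
  have := isProbabilityMeasure_pi_gammaLaw ha
  have hasc : 0 ≤ ∏ i, (ascPochhammer ℝ (m i)).eval (a i) :=
    Finset.prod_nonneg fun i _ => ascPochhammer_eval_nonneg (ha i) _
  have laplace := (ae_nonneg_pi_gammaLaw ha).mp <| (ae_sum_pos_pi_gammaLaw ha hs).mono
    fun g hgs hg => ofReal_prod_normalize_pow hg hgs hm
  rw [dirichletLaw, lintegral_map (by fun_prop) measurable_normalize, lintegral_congr_ae laplace,
    lintegral_lintegral_swap (by fun_prop), ← lintegral_const_mul _ (by fun_prop)]
  refine setLIntegral_congr_fun measurableSet_Ioi fun t ht => ?_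
  have ht : 0 < t := ht
  rw [lintegral_const_mul _ (by fun_prop), lintegral_prod_pow_mul_exp_pi_gammaLaw ha ht.le, hm,
    ← ENNReal.ofReal_mul (by positivity), ← ENNReal.ofReal_mul hasc]
  ring_nf

-- `Dir(A)` on a single coordinate is the point mass at `1`, which evaluates the integral.
theorem ofReal_ascPochhammer_mul_lintegral_eq_one {A : ℝ} (hA : 0 < A) (e : ℕ) :
    ENNReal.ofReal ((ascPochhammer ℝ (e + 1)).eval A)
        * ∫⁻ t in Set.Ioi (0 : ℝ), ENNReal.ofReal
          ((e.factorial : ℝ)⁻¹ * t ^ e * (1 + t) ^ (-(A + (e + 1 : ℕ)))) = 1 := by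
  have hA' : ∀ i : Unit, 0 ≤ (fun _ => A) i := fun _ => hA.le
  have := isProbabilityMeasure_dirichletLaw hA'
  have key := lintegral_prod_pow_dirichletLaw hA' (by simpa using hA) (fun _ => e + 1)
    (e := e) (by simp)
  have hone : ∀ᵐ w ∂dirichletLaw (fun _ : Unit => A),
      ENNReal.ofReal (∏ i, w i ^ (e + 1)) = 1 := by
    filter_upwards [ae_sum_eq_one_dirichletLaw hA' (by simpa using hA)] with w hw
    simp_all
  rw [lintegral_congr_ae hone] at key
  simpa using key.symm

theorem integral_prod_pow_dirichletLaw (ha : ∀ i, 0 ≤ a i) (hs : 0 < ∑ i, a i) (m : ι → ℕ) :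
    ∫ w, ∏ i, w i ^ m i ∂dirichletLaw a
      = (∏ i, (ascPochhammer ℝ (m i)).eval (a i))
        / (ascPochhammer ℝ (∑ i, m i)).eval (∑ i, a i) := by
  have := isProbabilityMeasure_dirichletLaw ha
  rcases hd : ∑ i, m i with _ | e
  · simp [fun i => (Finset.sum_eq_zero_iff.1 hd) i (Finset.mem_univ i)]
  have hasc := ascPochhammer_pos (e + 1) _ hs
  have hone := ofReal_ascPochhammer_mul_lintegral_eq_one hs e
  have hnonneg : 0 ≤ᵐ[dirichletLaw a] fun w => ∏ i, w i ^ m i := by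
    filter_upwards [ae_nonneg_dirichletLaw ha] with w hw
    exact Finset.prod_nonneg fun i _ => pow_nonneg (hw i) _
  rw [integral_eq_lintegral_of_nonneg_ae hnonneg
    (Continuous.aestronglyMeasurable (by fun_prop)), lintegral_prod_pow_dirichletLaw ha hs m hd,
    ENNReal.eq_inv_of_mul_eq_one_left ((mul_comm _ _).trans hone), ENNReal.toReal_mul,
    ENNReal.toReal_inv, ENNReal.toReal_ofReal hasc.le, ENNReal.toReal_ofReal
    (Finset.prod_nonneg fun i _ => ascPochhammer_eval_nonneg (ha i) _), div_eq_mul_inv]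

theorem integral_mul_dirichletLaw [DecidableEq ι] (ha : ∀ i, 0 ≤ a i) (hs : 0 < ∑ i, a i)
    (i j : ι) :
    ∫ w, w i * w j ∂dirichletLaw a
      = (a i * a j + if i = j then a i else 0) / ((∑ i, a i) * (∑ i, a i + 1)) := by
  have moment := integral_prod_pow_dirichletLaw ha hs
    fun k => (if k = i then 1 else 0) + if k = j then 1 else 0
  have numerator (k : ι) :
      (ascPochhammer ℝ ((if k = i then 1 else 0) + if k = j then 1 else 0)).eval (a k)
        = (if k = i then a k else 1) * (if k = j then a k + (if k = i then 1 else 0) else 1) := by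
    split_ifs <;> simp [ascPochhammer_succ_eval]
  have denominator : (ascPochhammer ℝ (1 + 1)).eval (∑ i, a i)
      = (∑ i, a i) * (∑ i, a i + 1) := by
    simp [ascPochhammer_succ_eval]
  simp only [pow_add, Finset.prod_mul_distrib, pow_ite, pow_one, pow_zero, Finset.prod_ite_eq',
    Finset.sum_add_distrib, Finset.sum_ite_eq', Finset.mem_univ, if_true, numerator,
    denominator] at moment
  rw [moment]
  rcases eq_or_ne i j with rfl | hij
  · simp [mul_add]
  · simp [hij, hij.symm]

theorem integral_quadraticForm_dirichletLaw (ha : ∀ i, 0 ≤ a i) (hs : 0 < ∑ i, a i)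
    (K : ι → ι → ℝ) :
    ∫ w, ∑ i, ∑ j, w i * w j * K i j ∂dirichletLaw a
      = (∑ i, ∑ j, a i * a j * K i j + ∑ i, a i * K i i)
        / ((∑ i, a i) * (∑ i, a i + 1)) := by
  classical
  rw [integral_finsetSum _ fun i _ => integrable_dirichletLaw ha (by fun_prop)]
  have row (i : ι) : ∫ w, ∑ j, w i * w j * K i j ∂dirichletLaw a
      = ∑ j, (∫ w, w i * w j ∂dirichletLaw a) * K i j := by
    rw [integral_finsetSum _ fun j _ => integrable_dirichletLaw ha (by fun_prop)]
    simp_rw [integral_mul_const]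
  simp_rw [row, integral_mul_dirichletLaw ha hs, div_mul_eq_mul_div, ← Finset.sum_div,
    add_mul, Finset.sum_add_distrib, ite_mul, zero_mul]
  simp

theorem integral_norm_sq_sum_smul_dirichletLaw {H : Type*} [NormedAddCommGroup H]
    [InnerProductSpace ℝ H] (ha : ∀ i, 0 ≤ a i) (hs : 0 < ∑ i, a i) (x : ι → H) :
    ∫ w, ‖∑ i, w i • x i‖ ^ 2 ∂dirichletLaw a
      = (‖∑ i, a i • x i‖ ^ 2 + ∑ i, a i * ‖x i‖ ^ 2) / ((∑ i, a i) * (∑ i, a i + 1)) := by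
  have expand (w : ι → ℝ) :
      ‖∑ i, w i • x i‖ ^ 2 = ∑ i, ∑ j, w i * w j * inner ℝ (x i) (x j) := by
    simp_rw [← real_inner_self_eq_norm_sq, sum_inner, inner_sum, real_inner_smul_left,
      real_inner_smul_right, mul_assoc]
  simp_rw [expand, integral_quadraticForm_dirichletLaw ha hs, real_inner_self_eq_norm_sq]

theorem integral_prod_comp_dirichletLaw_le (ha : ∀ i, 0 ≤ a i) (hs : 0 < ∑ i, a i) {r : ℝ}
    (har : ∀ i, a i ≤ r) {d : ℕ} (v : Fin d → ι) :
    ∫ w, ∏ k, w (v k) ∂dirichletLaw a ≤ ((r + d) / ∑ i, a i) ^ d := by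
  classical
  let m : ι → ℕ := fun i => (Finset.univ.filter fun k => v k = i).card
  have hm : ∑ i, m i = d := by
    simpa using (Finset.card_eq_sum_card_fiberwise (s := Finset.univ) (t := Finset.univ) (f := v)
      (by simp)).symm
  have hprod (w : ι → ℝ) : ∏ k, w (v k) = ∏ i, w i ^ m i := by
    rw [← Finset.prod_fiberwise (s := Finset.univ) (g := v)]
    refine Finset.prod_congr rfl fun i _ => ?_
    rw [Finset.prod_congr rfl (g := fun _ => w i) (by simp +contextual), Finset.prod_const]
  have hfactor (i : ι) : (ascPochhammer ℝ (m i)).eval (a i) ≤ (r + d) ^ m i := by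
    refine (ascPochhammer_eval_le_pow (ha i) _).trans ?_
    have := ha i
    have : m i ≤ d := hm ▸ Finset.single_le_sum (fun i _ => (m i).zero_le) (Finset.mem_univ i)
    gcongr
    exact har i
  simp_rw [hprod, integral_prod_pow_dirichletLaw ha hs, hm, div_pow]
  refine div_le_div₀ ?_ ?_ (by positivity) (pow_le_ascPochhammer_eval hs.le d)
  · obtain ⟨i, -, -⟩ := Finset.exists_ne_zero_of_sum_ne_zero hs.ne'
    have := (ha i).trans (har i)
    positivity
  · calc ∏ i, (ascPochhammer ℝ (m i)).eval (a i)
        ≤ ∏ i, (r + d) ^ m i :=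
          Finset.prod_le_prod (fun i _ => ascPochhammer_eval_nonneg (ha i) _) fun i _ => hfactor i
      _ = (r + d) ^ d := by rw [Finset.prod_pow_eq_pow_sum, hm]

theorem integral_prod_sum_dirichletLaw_le (ha : ∀ i, 0 ≤ a i) (hs : 0 < ∑ i, a i) {r : ℝ}
    (har : ∀ i, a i ≤ r) {d : ℕ} {F : Fin d → ι → ℝ} (hF : ∀ k i, 0 ≤ F k i) :
    ∫ w, ∏ k, ∑ i, w i * F k i ∂dirichletLaw a
      ≤ ((r + d) / ∑ i, a i) ^ d * ∏ k, ∑ i, F k i := by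
  classical
  simp_rw [Finset.prod_univ_sum, Finset.prod_mul_distrib, Finset.mul_sum]
  rw [integral_finsetSum _ fun v _ => integrable_dirichletLaw ha (by fun_prop)]
  simp_rw [integral_mul_const]
  gcongr with v
  · exact Finset.prod_nonneg fun k _ => hF k _
  · exact integral_prod_comp_dirichletLaw_le ha hs har v

end Dirichlet

section DirichletProcess

variable {S : Type*} [MeasurableSpace S] {ν : Measure S} {Q : Measure (Measure S)}

/-- The random probability measure with law `Q` has mixed second moments controlled by `ν`. Both
the Dirichlet process with base measure `s • ν` and the constant measure `ν` have this property. -/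
structure IsDominatedPrior (ν : Measure S) (Q : Measure (Measure S)) : Prop where
  ae_isProbabilityMeasure : ∀ᵐ M ∂Q, IsProbabilityMeasure M
  lintegral_mul_le : ∀ f g : S → ENNReal, Measurable f → Measurable g →
    ∫⁻ M, (∫⁻ z, f z ∂M) * (∫⁻ z, g z ∂M) ∂Q
      ≤ ∫⁻ z, f z * g z ∂ν + (∫⁻ z, f z ∂ν) * ∫⁻ z, g z ∂ν

theorem isDominatedPrior_dirac (ν : Measure S) [IsProbabilityMeasure ν] :
    IsDominatedPrior ν (Measure.dirac ν) where
  ae_isProbabilityMeasure := by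
    simp_rw [isProbabilityMeasure_iff]
    exact (ae_dirac_iff (measurableSet_eq_fun (Measure.measurable_coe .univ)
      measurable_const)).2 measure_univ
  lintegral_mul_le _ _ hf hg := (lintegral_dirac' _ ((Measure.measurable_lintegral hf).mul
    (Measure.measurable_lintegral hg))).trans_le le_add_self

theorem lintegral_mul_lintegral_le {ρ : Measure S} {h : Measure S → ENNReal} (hh : Measurable h)
    (hρ : ∀ B, MeasurableSet B → ∫⁻ M, h M * M B ∂Q ≤ ρ B) {g : S → ENNReal} (hg : Measurable g) :
    ∫⁻ M, h M * ∫⁻ z, g z ∂M ∂Q ≤ ∫⁻ z, g z ∂ρ := by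
  have hle : (Q.withDensity h).join ≤ ρ := Measure.le_iff.2 fun B hB => by
    rw [Measure.join_apply hB, lintegral_withDensity_eq_lintegral_mul _ hh
      (Measure.measurable_coe hB)]
    exact hρ B hB
  calc ∫⁻ M, h M * ∫⁻ z, g z ∂M ∂Q = ∫⁻ z, g z ∂(Q.withDensity h).join := by
        rw [Measure.lintegral_join hg.aemeasurable, lintegral_withDensity_eq_lintegral_mul _ hh
          (Measure.measurable_lintegral hg)]
        rfl
    _ ≤ _ := lintegral_mono' hle le_rfl

theorem measurable_measureReal {A : Set S} (hA : MeasurableSet A) :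
    Measurable fun M : Measure S => M.real A :=
  (Measure.measurable_coe hA).ennreal_toReal

theorem measureReal_preimage_eq_sum_indicator [IsFiniteMeasure ν] {m : ℕ} {T : S → Fin m}
    (hT : Measurable T) (I : Finset (Fin m)) :
    ν.real (T ⁻¹' I) = ∑ i, ν.real (T ⁻¹' {i}) * (I : Set (Fin m)).indicator 1 i := by
  rw [← sum_measureReal_preimage_singleton I fun i _ => hT (measurableSet_singleton i)]
  simp [Set.indicator_apply]

namespace IsDirichletProcess

theorem map_preimage_singleton (hQ : IsDirichletProcess ν Q) {m : ℕ} {T : S → Fin m}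
    (hT : Measurable T) :
    Q.map (fun M i => M.real (T ⁻¹' {i})) = dirichletLaw fun i => ν.real (T ⁻¹' {i}) :=
  hQ.map_partition m _ (fun _ => hT (measurableSet_singleton _))
    (pairwise_disjoint_fiber T)
    (Set.eq_univ_of_forall fun x => Set.mem_iUnion.2 ⟨T x, rfl⟩)

theorem integral_measureReal_preimage_mul [IsFiniteMeasure ν] [NeZero ν]
    (hQ : IsDirichletProcess ν Q) {m : ℕ} {T : S → Fin m} (hT : Measurable T)
    (I J : Finset (Fin m)) :
    ∫ M, M.real (T ⁻¹' I) * M.real (T ⁻¹' J) ∂Q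
      = (ν.real (T ⁻¹' I) * ν.real (T ⁻¹' J) + ν.real (T ⁻¹' (I ∩ J : Finset (Fin m))))
        / (ν.real Set.univ * (ν.real Set.univ + 1)) := by
  let χ (I : Finset (Fin m)) : Fin m → ℝ := (I : Set (Fin m)).indicator 1
  have mass : ∑ i, ν.real (T ⁻¹' {i}) = ν.real Set.univ := by
    simpa using sum_measureReal_preimage_singleton Finset.univ (μ := ν)
      fun i _ => hT (measurableSet_singleton i)
  have law_eq : ∫ M, M.real (T ⁻¹' I) * M.real (T ⁻¹' J) ∂Q
      = ∫ w, ∑ i, ∑ j, w i * w j * (χ I i * χ J j)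
          ∂dirichletLaw fun i => ν.real (T ⁻¹' {i}) := by
    rw [← hQ.map_preimage_singleton hT, integral_map (measurable_pi_lambda _ fun i =>
      measurable_measureReal (hT (measurableSet_singleton i))).aemeasurable
      (Continuous.aestronglyMeasurable (by fun_prop))]
    refine integral_congr_ae ?_
    filter_upwards [hQ.ae_isProbabilityMeasure] with M hM
    simp_rw [measureReal_preimage_eq_sum_indicator hT, Finset.sum_mul_sum, mul_mul_mul_comm, χ]
  rw [law_eq, integral_quadraticForm_dirichletLaw (fun i => measureReal_nonneg)
    (mass ▸ measureReal_univ_pos), mass]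
  simp_rw [measureReal_preimage_eq_sum_indicator hT, Finset.sum_mul_sum, mul_mul_mul_comm, χ,
    Finset.coe_inter, ← Set.inter_indicator_mul, Pi.one_apply, mul_one]
  rfl

theorem integral_measureReal_mul [IsFiniteMeasure ν] [NeZero ν] (hQ : IsDirichletProcess ν Q)
    {A B : Set S} (hA : MeasurableSet A) (hB : MeasurableSet B) :
    ∫ M, M.real A * M.real B ∂Q = (ν.real A * ν.real B + ν.real (A ∩ B))
      / (ν.real Set.univ * (ν.real Set.univ + 1)) := by
  classical
  let T : S → Fin 4 := fun x => (if x ∈ A then 1 else 0) + if x ∈ B then 2 else 0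
  have hT : Measurable T :=
    (measurable_const.ite hA measurable_const).add (measurable_const.ite hB measurable_const)
  have hTA : T ⁻¹' ({1, 3} : Finset (Fin 4)) = A := by
    ext x
    by_cases hxA : x ∈ A <;> by_cases hxB : x ∈ B <;> simp [T, hxA, hxB]
  have hTB : T ⁻¹' ({2, 3} : Finset (Fin 4)) = B := by
    ext x
    by_cases hxA : x ∈ A <;> by_cases hxB : x ∈ B <;> simp [T, hxA, hxB]
  have key := hQ.integral_measureReal_preimage_mul hT {1, 3} {2, 3}
  rwa [Finset.coe_inter, Set.preimage_inter, hTA, hTB] at key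

theorem lintegral_measure_mul_le {s : ℝ} (hs : 0 < s) [IsProbabilityMeasure ν]
    (hQ : IsDirichletProcess (ENNReal.ofReal s • ν) Q) {A B : Set S} (hA : MeasurableSet A)
    (hB : MeasurableSet B) : ∫⁻ M, M A * M B ∂Q ≤ ν (A ∩ B) + ν A * ν B := by
  have := hQ.isProbabilityMeasure
  have := ν.smul_finite (ENNReal.ofReal_ne_top (r := s))
  have : NeZero (ENNReal.ofReal s • ν) := ⟨by simp [hs, IsProbabilityMeasure.ne_zero ν]⟩
  have moment := hQ.integral_measureReal_mul hA hB
  simp only [measureReal_ennreal_smul_apply, probReal_univ, ENNReal.toReal_ofReal hs.le,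
    mul_one] at moment
  have hint : Integrable (fun M : Measure S => M.real A * M.real B) Q := by
    refine .of_bound ((measurable_measureReal hA).mul
      (measurable_measureReal hB)).aestronglyMeasurable 1 ?_
    filter_upwards [hQ.ae_isProbabilityMeasure] with M hM
    rw [Real.norm_of_nonneg (by positivity)]
    exact mul_le_one₀ measureReal_le_one measureReal_nonneg measureReal_le_one
  calc ∫⁻ M, M A * M B ∂Q = ∫⁻ M, ENNReal.ofReal (M.real A * M.real B) ∂Q := by
        refine lintegral_congr_ae ?_
        filter_upwards [hQ.ae_isProbabilityMeasure] with M hM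
        rw [ENNReal.ofReal_mul (by positivity), ofReal_measureReal, ofReal_measureReal]
    _ = ENNReal.ofReal
          ((s * ν.real A * (s * ν.real B) + s * ν.real (A ∩ B)) / (s * (s + 1))) := by
        rw [← ofReal_integral_eq_lintegral_ofReal hint (ae_of_all _ fun M => by positivity), moment]
    _ ≤ ENNReal.ofReal (ν.real (A ∩ B) + ν.real A * ν.real B) := by
        gcongr
        rw [div_le_iff₀ (by positivity)]
        have hAB : 0 ≤ ν.real A * ν.real B := by positivity
        have hinter : 0 ≤ s ^ 2 * ν.real (A ∩ B) := by positivity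
        nlinarith
    _ = ν (A ∩ B) + ν A * ν B := by
        rw [ENNReal.ofReal_add (by positivity) (by positivity), ENNReal.ofReal_mul (by positivity),
          ofReal_measureReal, ofReal_measureReal, ofReal_measureReal]

theorem isDominatedPrior {s : ℝ} (hs : 0 < s) [IsProbabilityMeasure ν]
    (hQ : IsDirichletProcess (ENNReal.ofReal s • ν) Q) : IsDominatedPrior ν Q where
  ae_isProbabilityMeasure := hQ.ae_isProbabilityMeasure
  lintegral_mul_le f g hf hg := by
    have one_set (B : Set S) (hB : MeasurableSet B) :
        ∫⁻ M, (∫⁻ z, f z ∂M) * M B ∂Q ≤ (ν.withDensity f + (∫⁻ z, f z ∂ν) • ν) B := by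
      simp_rw [mul_comm _ ((_ : Measure S) B)]
      refine (lintegral_mul_lintegral_le (ρ := ν.restrict B + ν B • ν) (Measure.measurable_coe hB)
        (fun A hA => ?_) hf).trans_eq ?_
      · refine (hQ.lintegral_measure_mul_le hs hB hA).trans_eq ?_
        simp [Measure.restrict_apply hA, Set.inter_comm]
      · rw [lintegral_add_measure, lintegral_smul_measure, Measure.add_apply, Measure.smul_apply,
          withDensity_apply _ hB, smul_eq_mul, smul_eq_mul, mul_comm]
    refine (lintegral_mul_lintegral_le (Measure.measurable_lintegral hf) one_set hg).trans_eq ?_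
    rw [lintegral_add_measure, lintegral_smul_measure, smul_eq_mul,
      lintegral_withDensity_eq_lintegral_mul _ hf hg]
    rfl

end IsDirichletProcess

end DirichletProcess

section StrongLaw

variable {S H : Type*} [MeasurableSpace S] [NormedAddCommGroup H] [InnerProductSpace ℝ H]
  {Ω : Type*} [MeasurableSpace Ω] {μ : Measure Ω} {P : Measure S} {Z : ℕ → Ω → S} {φ : S → H}
  {m : H}

theorem tendsto_div_of_tendsto_sq {T : ℕ → ℝ} {R : ℝ} (hT0 : ∀ n, 0 ≤ T n) (hR : 0 ≤ R)
    (hT : ∀ n k, T (n + k) ≤ T n + R * k)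
    (h : Tendsto (fun k : ℕ => T (k ^ 2) / (k : ℝ) ^ 2) atTop (𝓝 0)) :
    Tendsto (fun n : ℕ => T n / n) atTop (𝓝 0) := by
  have hsqrt : Tendsto Nat.sqrt atTop atTop :=
    tendsto_atTop.2 fun b => eventually_atTop.2 ⟨b * b, fun n hn => Nat.le_sqrt.2 hn⟩
  have hbound : Tendsto (fun k : ℕ => T (k ^ 2) / (k : ℝ) ^ 2 + 2 * R / (k : ℝ)) atTop (𝓝 0) := by
    simpa using h.add (tendsto_const_nhds.div_atTop tendsto_natCast_atTop_atTop)
  refine squeeze_zero' (.of_forall fun n => div_nonneg (hT0 n) n.cast_nonneg) ?_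
    (hbound.comp hsqrt)
  filter_upwards [eventually_ge_atTop 1] with n hn
  have : (0 : ℝ) < n.sqrt := by exact_mod_cast Nat.sqrt_pos.2 hn
  have hsq : n.sqrt ^ 2 ≤ n := Nat.sqrt_le' n
  have hgap : ((n - n.sqrt ^ 2 : ℕ) : ℝ) ≤ 2 * n.sqrt := by
    have := Nat.sqrt_le_add n
    exact_mod_cast show n - n.sqrt ^ 2 ≤ 2 * n.sqrt by rw [sq]; lia
  have hTn := hT (n.sqrt ^ 2) (n - n.sqrt ^ 2)
  rw [Nat.add_sub_cancel' hsq] at hTn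
  calc T n / n ≤ (T (n.sqrt ^ 2) + R * (2 * n.sqrt)) / (n.sqrt : ℝ) ^ 2 := by
        have := hT0 (n.sqrt ^ 2)
        exact div_le_div₀ (by positivity) (hTn.trans (by gcongr)) (by positivity)
          (by exact_mod_cast hsq)
    _ = T (n.sqrt ^ 2) / (n.sqrt : ℝ) ^ 2 + 2 * R / n.sqrt := by field_simp

theorem ae_tendsto_zero_of_summable_integral {F : ℕ → Ω → ℝ} (hF0 : ∀ k ω, 0 ≤ F k ω)
    (hFi : ∀ k, Integrable (F k) μ) (hF : Summable fun k => ∫ ω, F k ω ∂μ) :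
    ∀ᵐ ω ∂μ, Tendsto (fun k => F k ω) atTop (𝓝 0) := by
  have hmeas (k : ℕ) : AEMeasurable (fun ω => ENNReal.ofReal (F k ω)) μ :=
    (hFi k).aemeasurable.ennreal_ofReal
  have hsum : ∫⁻ ω, ∑' k, ENNReal.ofReal (F k ω) ∂μ ≠ ⊤ := by
    simp_rw [lintegral_tsum hmeas,
      ← ofReal_integral_eq_lintegral_ofReal (hFi _) (ae_of_all _ (hF0 _))]
    exact hF.tsum_ofReal_ne_top
  filter_upwards [ae_lt_top' (AEMeasurable.tsum hmeas) hsum] with ω hω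
  refine ((ENNReal.tendsto_toReal ENNReal.zero_ne_top).comp
    (ENNReal.tendsto_atTop_zero_of_tsum_ne_top hω.ne)).congr fun k => ?_
  exact ENNReal.toReal_ofReal (hF0 k ω)

theorem ae_tendsto_average_real (hlaw : ∀ i, HasLaw (Z i) P μ)
    (hindep : Pairwise fun i j => IndepFun (Z i) (Z j) μ) {f : S → ℝ} (hf : Measurable f)
    (hfP : Integrable f P) :
    ∀ᵐ ω ∂μ, Tendsto (fun n : ℕ => (∑ i ∈ Finset.range n, f (Z i ω)) / n) atTop
      (𝓝 (∫ z, f z ∂P)) := by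
  have hident (i : ℕ) : IdentDistrib (f ∘ Z i) (f ∘ Z 0) μ μ :=
    IdentDistrib.comp ⟨(hlaw i).aemeasurable, (hlaw 0).aemeasurable,
      (hlaw i).map_eq.trans (hlaw 0).map_eq.symm⟩ hf
  have mean_eq : ∫ ω, (f ∘ Z 0) ω ∂μ = ∫ z, f z ∂P :=
    (hlaw 0).integral_comp hf.aestronglyMeasurable
  rw [← mean_eq]
  exact strong_law_ae_real (fun i => f ∘ Z i)
    (((hlaw 0).map_eq ▸ hfP).comp_aemeasurable (hlaw 0).aemeasurable)
    (fun i j hij => (hindep hij).comp hf hf) hident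

theorem integral_inner_eq_zero_of_indepFun [IsFiniteMeasure μ] [SFinite P] {X Y : Ω → S}
    (hX : HasLaw X P μ) (hY : HasLaw Y P μ) (hXY : IndepFun X Y μ) (hφ : IsFeature φ)
    (hm : HasMean φ P 0) :
    ∫ ω, inner ℝ (φ (X ω)) (φ (Y ω)) ∂μ = 0 := by
  have hprod := (indepFun_iff_map_prod_eq_prod_map_map hX.aemeasurable hY.aemeasurable).1 hXY
  have hkernel := hm.integral_kernel hφ
  rw [hX.map_eq, hY.map_eq] at hprod
  rw [← hprod, integral_map (hX.aemeasurable.prodMk hY.aemeasurable)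
    hφ.measurable_kernel.aestronglyMeasurable] at hkernel
  simpa using hkernel

theorem integrable_and_integral_norm_sq_sum_le [IsProbabilityMeasure μ] [SFinite P]
    (hlaw : ∀ i, HasLaw (Z i) P μ) (hindep : Pairwise fun i j => IndepFun (Z i) (Z j) μ)
    (hφ : IsFeature φ) {R : ℝ} (hR : ∀ z, ‖φ z‖ ≤ R) (hm : HasMean φ P 0) (n : ℕ) :
    Integrable (fun ω => ‖∑ i ∈ Finset.range n, φ (Z i ω)‖ ^ 2) μ ∧
      ∫ ω, ‖∑ i ∈ Finset.range n, φ (Z i ω)‖ ^ 2 ∂μ ≤ R ^ 2 * n := by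
  have hpair (i j : ℕ) : AEMeasurable (fun ω => (Z i ω, Z j ω)) μ :=
    (hlaw i).aemeasurable.prodMk (hlaw j).aemeasurable
  have hbound (z z' : S) : ‖inner ℝ (φ z) (φ z')‖ ≤ R ^ 2 :=
    (norm_inner_le_norm _ _).trans ((mul_le_mul (hR z) (hR z') (norm_nonneg _)
      ((norm_nonneg _).trans (hR z))).trans_eq (sq R).symm)
  have hint (i j : ℕ) : Integrable (fun ω => inner ℝ (φ (Z i ω)) (φ (Z j ω))) μ :=
    .of_bound (hφ.measurable_kernel.comp_aemeasurable (hpair i j)).aestronglyMeasurable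
      (R ^ 2) (ae_of_all _ fun ω => hbound _ _)
  have expand (ω : Ω) : ‖∑ i ∈ Finset.range n, φ (Z i ω)‖ ^ 2
      = ∑ i ∈ Finset.range n, ∑ j ∈ Finset.range n, inner ℝ (φ (Z j ω)) (φ (Z i ω)) := by
    simp_rw [← real_inner_self_eq_norm_sq, inner_sum, sum_inner]
  simp_rw [expand]
  refine ⟨integrable_finsetSum _ fun i _ => integrable_finsetSum _ fun j _ => hint _ _, ?_⟩
  rw [integral_finsetSum _ fun i _ => integrable_finsetSum _ fun j _ => hint _ _, mul_comm,
    ← nsmul_eq_mul, ← Finset.card_range n, ← Finset.sum_const, Finset.card_range]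
  refine Finset.sum_le_sum fun i hi => ?_
  rw [integral_finsetSum _ fun j _ => hint _ _, Finset.sum_eq_single_of_mem i hi
    fun j _ hj =>
    integral_inner_eq_zero_of_indepFun (hlaw j) (hlaw i) (hindep hj) hφ hm]
  exact (Real.le_norm_self _).trans ((norm_integral_le_of_norm_le_const
    (ae_of_all _ fun ω => hbound _ _)).trans (by simp))

theorem ae_tendsto_average_of_bounded [IsProbabilityMeasure μ] [SFinite P]
    (hlaw : ∀ i, HasLaw (Z i) P μ) (hindep : Pairwise fun i j => IndepFun (Z i) (Z j) μ)
    (hφ : IsFeature φ) {R : ℝ} (hR : ∀ z, ‖φ z‖ ≤ R) (hm : HasMean φ P 0) :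
    ∀ᵐ ω ∂μ, Tendsto (fun n : ℕ => (n : ℝ)⁻¹ • ∑ i ∈ Finset.range n, φ (Z i ω)) atTop (𝓝 0) := by
  have variance_bound (k : ℕ) := integrable_and_integral_norm_sq_sum_le hlaw hindep hφ hR hm (k ^ 2)
  have hsummable : Summable fun k : ℕ =>
      ∫ ω, ‖∑ i ∈ Finset.range (k ^ 2), φ (Z i ω)‖ ^ 2 / (k : ℝ) ^ 4 ∂μ := by
    refine .of_nonneg_of_le (fun k => integral_nonneg fun ω => by positivity) (fun k => ?_)
      ((Real.summable_one_div_nat_pow.2 one_lt_two).mul_left (R ^ 2))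
    rw [integral_div]
    rcases k.eq_zero_or_pos with rfl | hk
    · simp
    · rw [div_le_iff₀ (by positivity)]
      refine (variance_bound k).2.trans_eq ?_
      push_cast
      field_simp
  filter_upwards [ae_tendsto_zero_of_summable_integral (fun k ω => by positivity)
    (fun k => (variance_bound k).1.div_const _) hsummable] with ω hω
  simp_rw [tendsto_zero_iff_norm_tendsto_zero (E := H), norm_smul, norm_inv, Real.norm_natCast,
    inv_mul_eq_div]
  refine tendsto_div_of_tendsto_sq (R := R) (fun n => norm_nonneg _)
    ((norm_nonneg _).trans (hR (Z 0 ω))) (fun n k => ?_) ?_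
  · rw [Finset.sum_range_add]
    refine (norm_add_le _ _).trans (add_le_add le_rfl ((norm_sum_le _ _).trans ?_))
    exact (Finset.sum_le_sum fun i _ => hR _).trans_eq (by simp [mul_comm])
  · refine (Real.sqrt_zero ▸ hω.sqrt).congr fun k => ?_
    rw [Real.sqrt_div' _ (by positivity), Real.sqrt_sq (norm_nonneg _),
      show (k : ℝ) ^ 4 = ((k : ℝ) ^ 2) ^ 2 by ring, Real.sqrt_sq (by positivity)]

theorem tendsto_integral_norm_indicator_lt {E : Type*} [NormedAddCommGroup E] {φ : S → E}
    (hφ : Measurable fun z => ‖φ z‖)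
    (hφP : Integrable (fun z => ‖φ z‖) P) :
    Tendsto (fun K : ℕ => ∫ z, ‖{z | (K : ℝ) < ‖φ z‖}.indicator φ z‖ ∂P) atTop (𝓝 0) := by
  have hmeas (K : ℕ) : MeasurableSet {z | (K : ℝ) < ‖φ z‖} := measurableSet_lt measurable_const hφ
  have hanti : Antitone fun K : ℕ => {z | (K : ℝ) < ‖φ z‖} :=
    fun K L hKL z (hz : (L : ℝ) < ‖φ z‖) => lt_of_le_of_lt (Nat.cast_le.2 hKL) hz
  have hempty : ⋂ K : ℕ, {z | (K : ℝ) < ‖φ z‖} = ∅ := by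
    refine Set.eq_empty_of_forall_notMem fun z hz => ?_
    obtain ⟨K, hK⟩ := exists_nat_ge ‖φ z‖
    exact (Set.mem_iInter.1 hz K).not_ge hK
  have hlim := tendsto_setIntegral_of_antitone hmeas hanti ⟨0, hφP.integrableOn⟩
  simp_rw [norm_indicator_eq_indicator_norm, integral_indicator (hmeas _)]
  simpa [hempty] using hlim

theorem tendsto_average_of_approx {x : ℕ → H} {y : ℕ → ℕ → H} {c : ℕ → H} {τ : ℕ → ℝ}
    (hy : ∀ K, Tendsto (fun n : ℕ => (n : ℝ)⁻¹ • ∑ i ∈ Finset.range n, (y K i - c K)) atTop (𝓝 0))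
    (hxy : ∀ K, Tendsto (fun n : ℕ => (∑ i ∈ Finset.range n, ‖x i - y K i‖) / n) atTop (𝓝 (τ K)))
    (hc : ∀ K, ‖c K‖ ≤ τ K) (hτ : Tendsto τ atTop (𝓝 0)) :
    Tendsto (fun n : ℕ => (n : ℝ)⁻¹ • ∑ i ∈ Finset.range n, x i) atTop (𝓝 0) := by
  rw [Metric.tendsto_nhds]
  intro ε hε
  obtain ⟨K, hK⟩ := ((hτ.const_mul 2).eventually_lt_const (by simpa using hε)).exists
  have hbound := ((hy K).norm.add (hxy K)).add_const (τ K)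
  rw [norm_zero, zero_add, ← two_mul] at hbound
  filter_upwards [hbound.eventually_lt_const hK, eventually_ne_atTop 0] with n hn hn0
  rw [dist_zero_right]
  refine lt_of_le_of_lt ?_ hn
  have split : (n : ℝ)⁻¹ • ∑ i ∈ Finset.range n, x i
      = (n : ℝ)⁻¹ • ∑ i ∈ Finset.range n, (y K i - c K)
        + (n : ℝ)⁻¹ • ∑ i ∈ Finset.range n, (x i - y K i) + c K := by
    have : (n : ℝ)⁻¹ • n • c K = c K := by
      rw [← Nat.cast_smul_eq_nsmul ℝ, inv_smul_smul₀ (by exact_mod_cast hn0)]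
    simp only [Finset.sum_sub_distrib, Finset.sum_const, Finset.card_range, smul_sub, this]
    abel
  rw [split]
  refine (norm_add₃_le).trans (add_le_add (add_le_add le_rfl ?_) (hc K))
  rw [norm_smul, norm_inv, Real.norm_natCast, inv_mul_eq_div]
  gcongr
  exact norm_sum_le _ _

theorem ae_tendsto_average [CompleteSpace H] [IsProbabilityMeasure P]
    (hlaw : ∀ i, HasLaw (Z i) P μ) (hindep : Pairwise fun i j => IndepFun (Z i) (Z j) μ)
    (hφ : IsFeature φ) (hm : HasMean φ P 0) :
    ∀ᵐ ω ∂μ, Tendsto (fun n : ℕ => (n : ℝ)⁻¹ • ∑ i ∈ Finset.range n, φ (Z i ω)) atTop (𝓝 0) := by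
  have := (hlaw 0).isProbabilityMeasure
  let A (K : ℕ) : Set S := {z | (K : ℝ) < ‖φ z‖}
  have hA (K : ℕ) : MeasurableSet (A K) := measurableSet_lt measurable_const hφ.measurable_norm
  have hhead (K : ℕ) : IsFeature ((A K)ᶜ.indicator φ) := hφ.indicator (hA K).compl
  have head_le (K : ℕ) (z : S) : ‖(A K)ᶜ.indicator φ z‖ ≤ K := by
    by_cases hz : z ∈ A K
    · simp [hz]
    · simpa [hz] using not_lt.1 hz
  have tail_eq (K : ℕ) (z : S) : φ z - (A K)ᶜ.indicator φ z = (A K).indicator φ z :=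
    sub_eq_iff_eq_add.2 (Set.indicator_self_add_compl_apply (A K) φ z).symm
  choose c hc using fun K => (hhead K).exists_hasMean (M := P)
    (.of_bound (hhead K).measurable_norm.aestronglyMeasurable K
      (ae_of_all _ fun z => by simpa using head_le K z))
  have mean_le (K : ℕ) : ‖c K‖ ≤ ∫ z, ‖(A K).indicator φ z‖ ∂P := by
    have hsub := hm.sub (hc K) (by simpa only [tail_eq] using hφ.indicator (hA K))
    simpa [tail_eq] using hsub.norm_le
  have head_law := ae_all_iff.2 fun K => ae_tendsto_average_of_bounded hlaw hindep
    ((hhead K).sub_const (c K)) (R := K + ‖c K‖)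
    (fun z => (norm_sub_le _ _).trans (add_le_add (head_le K z) le_rfl))
    (by simpa using (hc K).sub (hasMean_const (c K)) ((hhead K).sub_const (c K)))
  have tail_law := ae_all_iff.2 fun K => ae_tendsto_average_real hlaw hindep
    (hφ.indicator (hA K)).measurable_norm
    (by simpa only [norm_indicator_eq_indicator_norm] using hm.integrable_norm.indicator (hA K))
  filter_upwards [head_law, tail_law] with ω hhead_ω htail_ω
  exact tendsto_average_of_approx hhead_ω (fun K => by simpa only [tail_eq] using htail_ω K) mean_le
    (tendsto_integral_norm_indicator_lt hφ.measurable_norm hm.integrable_norm)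

/-- The averages of `ξ` tend to zero and those of `‖ξ‖` converge: what is needed of a centred
sample. -/
structure IsCentered (ξ : ℕ → H) : Prop where
  tendsto_average : Tendsto (fun n : ℕ => (n : ℝ)⁻¹ • ∑ i ∈ Finset.range n, ξ i) atTop (𝓝 0)
  exists_tendsto_average_norm :
    ∃ L, Tendsto (fun n : ℕ => (∑ i ∈ Finset.range n, ‖ξ i‖) / n) atTop (𝓝 L)

theorem HasMean.ae_isCentered [CompleteSpace H] [IsProbabilityMeasure P] (hm : HasMean φ P m)
    (hφ : IsFeature φ) (hlaw : ∀ i, HasLaw (Z i) P μ)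
    (hindep : Pairwise fun i j => IndepFun (Z i) (Z j) μ) :
    ∀ᵐ ω ∂μ, IsCentered fun i => φ (Z i ω) - m := by
  have hsub := hφ.sub_const m
  have hmean : HasMean (fun z => φ z - m) P 0 := by simpa using hm.sub (hasMean_const m) hsub
  filter_upwards [ae_tendsto_average hlaw hindep hsub hmean,
    ae_tendsto_average_real hlaw hindep hsub.measurable_norm hmean.integrable_norm] with ω h h'
  exact ⟨h, _, h'⟩

theorem isLittleO_of_tendsto_average {c : ℕ → ℝ} {L : ℝ}
    (hL : Tendsto (fun n : ℕ => (∑ i ∈ Finset.range n, c i) / n) atTop (𝓝 L)) :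
    c =o[atTop] fun i => (i : ℝ) + 1 := by
  refine (Asymptotics.isLittleO_iff_tendsto fun _ hi => absurd hi (by positivity)).2 ?_
  have hshift := hL.mul (tendsto_natCast_div_add_atTop (1 : ℝ))
  have hdiff := (hL.comp (tendsto_add_atTop_nat 1)).sub hshift
  rw [mul_one, sub_self] at hdiff
  refine hdiff.congr' ?_
  filter_upwards [eventually_ne_atTop 0] with n hn
  have : (n : ℝ) ≠ 0 := by exact_mod_cast hn
  simp only [Function.comp_apply, Finset.sum_range_succ, Nat.cast_add, Nat.cast_one]
  field_simp
  ring

theorem isBigO_sum_succ_mul_succ_of_tendsto_average {c : ℕ → ℝ} (hc : ∀ i, 0 ≤ c i) {L : ℝ}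
    (hL : Tendsto (fun n : ℕ => (∑ i ∈ Finset.range n, c i) / n) atTop (𝓝 L)) :
    (fun n : ℕ => ∑ i ∈ Finset.range n, ((i : ℝ) + 1) * (c i + 1))
      =O[atTop] fun n : ℕ => (n : ℝ) ^ 2 := by
  obtain ⟨C, hC⟩ := hL.bddAbove_range
  refine .of_bound (C + 1) (.of_forall fun n => ?_)
  rw [Real.norm_of_nonneg (Finset.sum_nonneg fun i _ => mul_nonneg (by positivity)
    (by linarith [hc i])), Real.norm_of_nonneg (by positivity)]
  rcases n.eq_zero_or_pos with rfl | hn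
  · simp
  have hCn : (∑ i ∈ Finset.range n, c i) ≤ C * n :=
    (div_le_iff₀ (by positivity)).1 (hC ⟨n, rfl⟩)
  calc ∑ i ∈ Finset.range n, ((i : ℝ) + 1) * (c i + 1)
      ≤ ∑ i ∈ Finset.range n, (n : ℝ) * (c i + 1) := by
        refine Finset.sum_le_sum fun i hi => mul_le_mul_of_nonneg_right ?_ (by linarith [hc i])
        exact_mod_cast Finset.mem_range.1 hi
    _ = n * (∑ i ∈ Finset.range n, c i + n) := by
        rw [← Finset.mul_sum, Finset.sum_add_distrib]
        simp
    _ ≤ n * (C * n + n) := by gcongr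
    _ = (C + 1) * (n : ℝ) ^ 2 := by ring

theorem tendsto_sum_sq_div_sq_of_tendsto_average {c : ℕ → ℝ} (hc : ∀ i, 0 ≤ c i) {L : ℝ}
    (hL : Tendsto (fun n : ℕ => (∑ i ∈ Finset.range n, c i) / n) atTop (𝓝 L)) :
    Tendsto (fun n : ℕ => (∑ i ∈ Finset.range n, c i ^ 2) / (n : ℝ) ^ 2) atTop (𝓝 0) := by
  have sq_isLittleO : (fun i => c i ^ 2) =o[atTop] fun i => ((i : ℝ) + 1) * (c i + 1) := by
    simp_rw [sq]
    refine (isLittleO_of_tendsto_average hL).mul_isBigO (.of_bound 1 (.of_forall fun i => ?_))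
    rw [Real.norm_of_nonneg (hc i), Real.norm_of_nonneg (by linarith [hc i])]
    linarith
  have weight_tendsto : Tendsto (fun n : ℕ => ∑ i ∈ Finset.range n, ((i : ℝ) + 1) * (c i + 1))
      atTop atTop := by
    refine tendsto_atTop_mono (fun n => ?_) tendsto_natCast_atTop_atTop
    calc (n : ℝ) = ∑ _i ∈ Finset.range n, (1 : ℝ) := by simp
      _ ≤ _ := Finset.sum_le_sum fun i _ => one_le_mul_of_one_le_of_one_le (by simp)
        (by linarith [hc i])
  exact ((sq_isLittleO.sum_range (fun i => mul_nonneg (by positivity) (by linarith [hc i]))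
    weight_tendsto).trans_isBigO
      (isBigO_sum_succ_mul_succ_of_tendsto_average hc hL)).tendsto_div_nhds_zero

end StrongLaw

section Weights

variable {H H' : Type*} [NormedAddCommGroup H] [InnerProductSpace ℝ H]
  [NormedAddCommGroup H'] [InnerProductSpace ℝ H'] {s : ℝ} {n : ℕ}

/-- The family `(x₀, x 0, …, x (n - 1))`: a prior component followed by a sample of size `n`. -/
def withPrior {E : Type*} (x₀ : E) (x : ℕ → E) (n : ℕ) : Fin (n + 1) → E :=
  Fin.cons x₀ fun i => x i

/-- The law `Dir (s, 1, …, 1)` of the posterior weights for a sample of size `n`. -/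
abbrev weightLaw (s : ℝ) (n : ℕ) : Measure (Fin (n + 1) → ℝ) :=
  dirichletLaw (withPrior s (fun _ => 1) n)

theorem sum_withPrior {E F : Type*} [AddCommMonoid F] (f : E → F) (x₀ : E) (x : ℕ → E) (n : ℕ) :
    ∑ i, f (withPrior x₀ x n i) = f x₀ + ∑ i ∈ Finset.range n, f (x i) := by
  simp [withPrior, Fin.sum_univ_succ, Finset.sum_range]

theorem withPrior_one_nonneg (hs : 0 ≤ s) (i : Fin (n + 1)) : 0 ≤ withPrior s (fun _ => 1) n i :=
  Fin.cases (by simpa [withPrior]) (fun _ => by simp [withPrior]) i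

theorem withPrior_one_le (hs : 0 ≤ s) (i : Fin (n + 1)) : withPrior s (fun _ => 1) n i ≤ s + 1 :=
  Fin.cases (by simp [withPrior]) (fun _ => by simpa [withPrior]) i

theorem sum_withPrior_one (s : ℝ) (n : ℕ) : ∑ i, withPrior s (fun _ => 1) n i = s + n := by
  simpa using sum_withPrior id s (fun _ => 1) n

theorem integral_norm_sq_sum_smul_withPrior_le (hs : 0 ≤ s) (hn : n ≠ 0) (ξ₀ : H) (ξ : ℕ → H) :
    ∫ w, ‖∑ i, w i • withPrior ξ₀ ξ n i‖ ^ 2 ∂weightLaw s n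
      ≤ ((2 * s ^ 2 + s) * ‖ξ₀‖ ^ 2 + 2 * ‖∑ i ∈ Finset.range n, ξ i‖ ^ 2
        + ∑ i ∈ Finset.range n, ‖ξ i‖ ^ 2) / (n : ℝ) ^ 2 := by
  have hn' : (0 : ℝ) < n := by exact_mod_cast hn.bot_lt
  have hmean : ∑ i, withPrior s (fun _ => 1) n i • withPrior ξ₀ ξ n i
      = s • ξ₀ + ∑ i ∈ Finset.range n, ξ i := by
    simp [withPrior, Fin.sum_univ_succ, Finset.sum_range]
  have hdiag : ∑ i, withPrior s (fun _ => 1) n i * ‖withPrior ξ₀ ξ n i‖ ^ 2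
      = s * ‖ξ₀‖ ^ 2 + ∑ i ∈ Finset.range n, ‖ξ i‖ ^ 2 := by
    simp [withPrior, Fin.sum_univ_succ, Finset.sum_range]
  have hsq : ‖s • ξ₀ + ∑ i ∈ Finset.range n, ξ i‖ ^ 2
      ≤ 2 * ((s * ‖ξ₀‖) ^ 2 + ‖∑ i ∈ Finset.range n, ξ i‖ ^ 2) := by
    refine (pow_le_pow_left₀ (norm_nonneg _) (norm_add_le _ _) 2).trans ?_
    rw [norm_smul, Real.norm_of_nonneg hs]
    exact add_sq_le
  rw [integral_norm_sq_sum_smul_dirichletLaw (withPrior_one_nonneg hs)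
    (by rw [sum_withPrior_one]; positivity), hmean, hdiag, sum_withPrior_one]
  refine div_le_div₀ (by positivity) ?_ (by positivity) ?_
  · linarith
  · nlinarith

theorem norm_sum_smul_withPrior_le {w : Fin (n + 1) → ℝ} (hw : ∀ i, 0 ≤ w i) (ξ₀ : H) (ξ : ℕ → H) :
    ‖∑ i, w i • withPrior ξ₀ ξ n i‖ ≤ ∑ i, w i * ‖withPrior ξ₀ ξ n i‖ := by
  refine (norm_sum_le _ _).trans_eq (Finset.sum_congr rfl fun i _ => ?_)
  rw [norm_smul, Real.norm_of_nonneg (hw i)]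

theorem integral_norm_sq_mul_norm_pow_four_le (hs : 0 ≤ s) (hn : n ≠ 0) (ξ₀ : H) (ξ : ℕ → H)
    (η₀ : H') (η : ℕ → H') :
    ∫ w, ‖∑ i, w i • withPrior ξ₀ ξ n i‖ ^ 2 * ‖∑ i, w i • withPrior η₀ η n i‖ ^ 4 ∂weightLaw s n
      ≤ ((s + 7) / n) ^ 6 * ((‖ξ₀‖ + ∑ i ∈ Finset.range n, ‖ξ i‖) ^ 2
        * (‖η₀‖ + ∑ i ∈ Finset.range n, ‖η i‖) ^ 4) := by
  have hn' : (0 : ℝ) < n := by exact_mod_cast hn.bot_lt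
  have hnonneg := withPrior_one_nonneg (n := n) hs
  let a (i : Fin (n + 1)) : ℝ := ‖withPrior ξ₀ ξ n i‖
  let b (i : Fin (n + 1)) : ℝ := ‖withPrior η₀ η n i‖
  have moment := integral_prod_sum_dirichletLaw_le hnonneg
    (by rw [sum_withPrior_one]; positivity) (withPrior_one_le hs) (F := ![a, a, b, b, b, b])
    (by simp [Fin.forall_fin_succ, a, b])
  simp only [Fin.prod_univ_six, Matrix.cons_val, sum_withPrior_one, a, b, sum_withPrior norm]
    at moment
  calc _ ≤ ∫ w, (∑ i, w i * a i) ^ 2 * (∑ i, w i * b i) ^ 4 ∂weightLaw s n := by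
        refine integral_mono_ae (integrable_dirichletLaw hnonneg (by fun_prop))
          (integrable_dirichletLaw hnonneg (by fun_prop)) ?_
        filter_upwards [ae_nonneg_dirichletLaw hnonneg] with w hw
        gcongr
        exacts [norm_sum_smul_withPrior_le hw ξ₀ ξ, norm_sum_smul_withPrior_le hw η₀ η]
    _ = ∫ w, (∑ i, w i * a i) * (∑ i, w i * a i) * (∑ i, w i * b i) * (∑ i, w i * b i)
          * (∑ i, w i * b i) * (∑ i, w i * b i) ∂weightLaw s n := by
        congr with w
        ring
    _ ≤ _ := moment
    _ ≤ ((s + 7) / n) ^ 6 * _ := by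
        refine mul_le_mul_of_nonneg_right ?_ (by positivity)
        gcongr ?_ ^ 6
        exact div_le_div₀ (by positivity) (by norm_num; linarith) hn' (by linarith)
    _ = _ := by ring

theorem IsCentered.tendsto_rate {ξ : ℕ → H} (hξ : IsCentered ξ) (C : ℝ) :
    Tendsto (fun n : ℕ => (C + 2 * ‖∑ i ∈ Finset.range n, ξ i‖ ^ 2
      + ∑ i ∈ Finset.range n, ‖ξ i‖ ^ 2) / (n : ℝ) ^ 2) atTop (𝓝 0) := by
  obtain ⟨L, hL⟩ := hξ.exists_tendsto_average_norm
  have hconst : Tendsto (fun n : ℕ => C / (n : ℝ) ^ 2) atTop (𝓝 0) :=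
    tendsto_const_nhds.div_atTop ((tendsto_pow_atTop two_ne_zero).comp tendsto_natCast_atTop_atTop)
  have hmean := (hξ.tendsto_average.norm.pow 2).const_mul 2
  have hsum := (hconst.add hmean).add
    (tendsto_sum_sq_div_sq_of_tendsto_average (fun i => norm_nonneg (ξ i)) hL)
  rw [norm_zero, zero_pow two_ne_zero, mul_zero, add_zero, add_zero] at hsum
  refine hsum.congr fun n => ?_
  rw [norm_smul, norm_inv, Real.norm_natCast]
  ring

theorem IsCentered.eventually_integral_norm_sq_le {ξ : ℕ → H} (hξ : IsCentered ξ) (hs : 0 ≤ s)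
    {ε : ℝ} (hε : 0 < ε) :
    ∀ᶠ n : ℕ in atTop, ∀ ξ₀ : H,
      ∫ w, ‖∑ i, w i • withPrior ξ₀ ξ n i‖ ^ 2 ∂weightLaw s n ≤ ε * (1 + ‖ξ₀‖ ^ 2) := by
  filter_upwards [(hξ.tendsto_rate (2 * s ^ 2 + s)).eventually_lt_const hε,
    eventually_ne_atTop 0] with n hrate hn ξ₀
  refine (integral_norm_sq_sum_smul_withPrior_le hs hn ξ₀ ξ).trans
    (le_trans ?_ (mul_le_mul_of_nonneg_right hrate.le (by positivity)))
  rw [div_mul_eq_mul_div]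
  gcongr
  have : 0 ≤ ∑ i ∈ Finset.range n, ‖ξ i‖ ^ 2 := Finset.sum_nonneg fun i _ => sq_nonneg _
  nlinarith [sq_nonneg ‖ξ₀‖, sq_nonneg ‖∑ i ∈ Finset.range n, ξ i‖,
    mul_nonneg this (sq_nonneg ‖ξ₀‖),
    mul_nonneg (sq_nonneg ‖∑ i ∈ Finset.range n, ξ i‖) (sq_nonneg ‖ξ₀‖), sq_nonneg s]

theorem IsCentered.exists_sq_add_sum_norm_le {ξ : ℕ → H} (hξ : IsCentered ξ) :
    ∃ C > 0, ∀ n : ℕ, n ≠ 0 → ∀ r : ℝ, 0 ≤ r →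
      (r + ∑ i ∈ Finset.range n, ‖ξ i‖) ^ 2 ≤ (n : ℝ) ^ 2 * (C * (1 + r ^ 2)) := by
  obtain ⟨L, hL⟩ := hξ.exists_tendsto_average_norm
  obtain ⟨C, hC⟩ := hL.bddAbove_range
  refine ⟨2 * (1 + C ^ 2), by positivity, fun n hn r hr => ?_⟩
  have hn' : (0 : ℝ) < n := by exact_mod_cast hn.bot_lt
  have hn1 : (1 : ℝ) ≤ n := by exact_mod_cast Nat.one_le_iff_ne_zero.2 hn
  have hsum : ∑ i ∈ Finset.range n, ‖ξ i‖ ≤ C * n := (div_le_iff₀ hn').1 (hC ⟨n, rfl⟩)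
  calc (r + ∑ i ∈ Finset.range n, ‖ξ i‖) ^ 2 ≤ (n * (r + C)) ^ 2 := by
        gcongr
        nlinarith
    _ = (n : ℝ) ^ 2 * (r + C) ^ 2 := by ring
    _ ≤ (n : ℝ) ^ 2 * (2 * (1 + C ^ 2) * (1 + r ^ 2)) := by
        gcongr
        nlinarith [add_sq_le (a := r) (b := C), sq_nonneg (C * r)]

theorem IsCentered.exists_integral_norm_sq_mul_norm_pow_four_le {ξ : ℕ → H} {η : ℕ → H'}
    (hξ : IsCentered ξ) (hη : IsCentered η) (hs : 0 ≤ s) :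
    ∃ C > 0, ∀ n : ℕ, n ≠ 0 → ∀ (ξ₀ : H) (η₀ : H'),
      ∫ w, ‖∑ i, w i • withPrior ξ₀ ξ n i‖ ^ 2 * ‖∑ i, w i • withPrior η₀ η n i‖ ^ 4 ∂weightLaw s n
        ≤ C * ((1 + ‖ξ₀‖ ^ 2) * (1 + ‖η₀‖ ^ 2) ^ 2) := by
  obtain ⟨A, hA, hξA⟩ := hξ.exists_sq_add_sum_norm_le
  obtain ⟨B, hB, hηB⟩ := hη.exists_sq_add_sum_norm_le
  refine ⟨(s + 7) ^ 6 * A * B ^ 2, by positivity, fun n hn ξ₀ η₀ => ?_⟩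
  have hn' : (n : ℝ) ≠ 0 := by exact_mod_cast hn
  calc _ ≤ ((s + 7) / n) ^ 6 * ((‖ξ₀‖ + ∑ i ∈ Finset.range n, ‖ξ i‖) ^ 2
          * ((‖η₀‖ + ∑ i ∈ Finset.range n, ‖η i‖) ^ 2) ^ 2) := by
        rw [← pow_mul]
        exact integral_norm_sq_mul_norm_pow_four_le hs hn ξ₀ ξ η₀ η
    _ ≤ ((s + 7) / n) ^ 6 * ((n : ℝ) ^ 2 * (A * (1 + ‖ξ₀‖ ^ 2))
          * ((n : ℝ) ^ 2 * (B * (1 + ‖η₀‖ ^ 2))) ^ 2) := by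
        gcongr
        exacts [hξA n hn _ (norm_nonneg _), hηB n hn _ (norm_nonneg _)]
    _ = _ := by field_simp

theorem IsCentered.eventually_integral_norm_sq_mul_norm_sq_le {ξ : ℕ → H} {η : ℕ → H'}
    (hξ : IsCentered ξ) (hη : IsCentered η) (hs : 0 ≤ s) {ε : ℝ} (hε : 0 < ε) :
    ∀ᶠ n : ℕ in atTop, ∀ (ξ₀ : H) (η₀ : H'),
      ∫ w, ‖∑ i, w i • withPrior ξ₀ ξ n i‖ ^ 2 * ‖∑ i, w i • withPrior η₀ η n i‖ ^ 2 ∂weightLaw s n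
        ≤ ε * ((1 + ‖ξ₀‖ ^ 2) * (1 + ‖η₀‖ ^ 2)) := by
  obtain ⟨C, hC, hξη⟩ := hξ.exists_integral_norm_sq_mul_norm_pow_four_le hη hs
  let r := ε / C
  have hr : 0 < r := div_pos hε hC
  filter_upwards [hξ.eventually_integral_norm_sq_le hs (mul_pos hε hr),
    eventually_ne_atTop 0] with n hsecond hn ξ₀ η₀
  let X (w : Fin (n + 1) → ℝ) := ‖∑ i, w i • withPrior ξ₀ ξ n i‖
  let Y (w : Fin (n + 1) → ℝ) := ‖∑ i, w i • withPrior η₀ η n i‖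
  let D := 1 + ‖η₀‖ ^ 2
  have hD : 0 < D := by positivity
  have hint {F : (Fin (n + 1) → ℝ) → ℝ} (hF : Continuous F) : Integrable F (weightLaw s n) :=
    integrable_dirichletLaw (withPrior_one_nonneg hs) hF
  have hX : Continuous X := by fun_prop
  have hY : Continuous Y := by fun_prop
  have am_gm (x y : ℝ) :
      x ^ 2 * y ^ 2 ≤ D / (2 * r) * x ^ 2 + r / (2 * D) * (x ^ 2 * y ^ 4) := by
    have : 0 ≤ x ^ 2 / (2 * r * D) * (D - r * y ^ 2) ^ 2 := by positivity
    refine sub_nonneg.1 (this.trans_eq ?_)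
    field_simp
    ring
  calc ∫ w, X w ^ 2 * Y w ^ 2 ∂weightLaw s n
      ≤ ∫ w, (D / (2 * r) * X w ^ 2 + r / (2 * D) * (X w ^ 2 * Y w ^ 4)) ∂weightLaw s n :=
        integral_mono (hint (by fun_prop)) (hint (by fun_prop)) fun w => am_gm _ _
    _ = D / (2 * r) * ∫ w, X w ^ 2 ∂weightLaw s n
          + r / (2 * D) * ∫ w, X w ^ 2 * Y w ^ 4 ∂weightLaw s n := by
        rw [integral_add (hint (by fun_prop)) (hint (by fun_prop)), integral_const_mul,
          integral_const_mul]
    _ ≤ D / (2 * r) * (ε * r * (1 + ‖ξ₀‖ ^ 2))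
          + r / (2 * D) * (C * ((1 + ‖ξ₀‖ ^ 2) * D ^ 2)) := by
        gcongr
        exacts [hsecond ξ₀, hξη n hn ξ₀ η₀]
    _ = ε * ((1 + ‖ξ₀‖ ^ 2) * D) := by
        simp only [r]
        field_simp
        ring

end Weights

section Measurability

variable {S : Type*} [MeasurableSpace S]

section Kernel

variable {α : Type*} [MeasurableSpace α] (κ : Kernel α S) [IsSFiniteKernel κ]

theorem stronglyMeasurable_integral_kernel_prod_self {f : S × S → ℝ} (hf : StronglyMeasurable f) :
    StronglyMeasurable fun a => ∫ p, f p ∂((κ a).prod (κ a)) := by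
  simpa only [Kernel.prod_apply] using hf.integral_kernel (κ := κ ×ₖ κ)

theorem stronglyMeasurable_integral_kernel_section {f : S × S → ℝ} (hf : StronglyMeasurable f) :
    StronglyMeasurable fun q : α × S => ∫ z, f (q.2, z) ∂κ q.1 := by
  have hf' : StronglyMeasurable fun r : (α × S) × S => f (r.1.2, r.2) :=
    hf.comp_measurable ((measurable_snd.comp measurable_fst).prodMk measurable_snd)
  simpa only [Kernel.prodMkRight_apply] using
    StronglyMeasurable.integral_kernel_prod_right (κ := κ.prodMkRight S)
      (f := fun q z => f (q.2, z)) hf'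

variable {𝒳 𝒴 : Type*} [MeasurableSpace 𝒳] [MeasurableSpace 𝒴] {kX : 𝒳 → 𝒳 → ℝ} {kY : 𝒴 → 𝒴 → ℝ}

theorem stronglyMeasurable_hsic_kernel (κ : Kernel α (𝒳 × 𝒴)) [IsSFiniteKernel κ]
    (hkX : Measurable fun p : (𝒳 × 𝒴) × (𝒳 × 𝒴) => kX p.1.1 p.2.1)
    (hkY : Measurable fun p : (𝒳 × 𝒴) × (𝒳 × 𝒴) => kY p.1.2 p.2.2) :
    StronglyMeasurable fun a => hsic kX kY (κ a) := by
  have hpair {f : (𝒳 × 𝒴) × (𝒳 × 𝒴) → ℝ} (hf : Measurable f) :=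
    stronglyMeasurable_integral_kernel_prod_self κ hf.stronglyMeasurable
  have cross : StronglyMeasurable fun q : α × (𝒳 × 𝒴) =>
      (∫ z, kX q.2.1 z.1 ∂κ q.1) * ∫ z, kY q.2.2 z.2 ∂κ q.1 :=
    (stronglyMeasurable_integral_kernel_section κ hkX.stronglyMeasurable).mul
      (stronglyMeasurable_integral_kernel_section κ hkY.stronglyMeasurable)
  exact ((hpair (hkX.mul hkY)).add ((hpair hkX).mul (hpair hkY))).sub
    (cross.integral_kernel_prod_right.const_mul 2)

end Kernel

/-- The kernel that evaluates measures of mass at most one, and sends the others to zero. It is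
finite, unlike the identity kernel on all measures, and agrees with it on posterior samples. -/
def subprobKernel (S : Type*) [MeasurableSpace S] : Kernel (Measure S) S where
  toFun M := open Classical in if M Set.univ ≤ 1 then M else 0
  measurable' := Measurable.ite
    (measurableSet_le (Measure.measurable_coe MeasurableSet.univ) measurable_const)
    measurable_id measurable_const

theorem subprobKernel_apply {M : Measure S} (hM : M Set.univ ≤ 1) : subprobKernel S M = M :=
  if_pos hM

instance : IsFiniteKernel (subprobKernel S) where
  exists_univ_le := by
    refine ⟨1, ENNReal.one_lt_top, fun M => ?_⟩
    change (if M Set.univ ≤ 1 then M else 0) Set.univ ≤ 1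
    split_ifs with h
    · exact h
    · simp

theorem aestronglyMeasurable_hsic {𝒳 𝒴 : Type*} [MeasurableSpace 𝒳] [MeasurableSpace 𝒴]
    {kX : 𝒳 → 𝒳 → ℝ} {kY : 𝒴 → 𝒴 → ℝ}
    (hkX : Measurable fun p : (𝒳 × 𝒴) × (𝒳 × 𝒴) => kX p.1.1 p.2.1)
    (hkY : Measurable fun p : (𝒳 × 𝒴) × (𝒳 × 𝒴) => kY p.1.2 p.2.2) {ρ : Measure (Measure (𝒳 × 𝒴))}
    (hρ : ∀ᵐ M ∂ρ, M Set.univ ≤ 1) : AEStronglyMeasurable (hsic kX kY) ρ := by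
  refine ⟨_, stronglyMeasurable_hsic_kernel (subprobKernel (𝒳 × 𝒴)) hkX hkY, ?_⟩
  filter_upwards [hρ] with M hM
  rw [subprobKernel_apply hM]

variable {s : ℝ} {n : ℕ} (z : Fin n → S)

theorem measurable_mixture :
    Measurable fun p : (Fin (n + 1) → ℝ) × Measure S => mixture z p.1 p.2 := by
  refine Measure.measurable_of_measurable_coe _ fun B hB => ?_
  simp only [mixture, Measure.add_apply, Measure.smul_apply, Measure.finsetSum_apply, smul_eq_mul]
  have := (Measure.measurable_coe hB).comp
    (measurable_snd : Measurable (Prod.snd : (Fin (n + 1) → ℝ) × Measure S → Measure S))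
  refine Measurable.add (Measurable.mul (by fun_prop) this) ?_
  fun_prop

theorem mixture_univ {w : Fin (n + 1) → ℝ} (hw : ∀ i, 0 ≤ w i) (M : Measure S)
    [IsProbabilityMeasure M] : mixture z w M Set.univ = ENNReal.ofReal (∑ i, w i) := by
  rw [Fin.sum_univ_succ, ENNReal.ofReal_add (hw 0) (Finset.sum_nonneg fun i _ => hw _),
    ENNReal.ofReal_sum_of_nonneg fun i _ => hw _]
  simp [mixture]

theorem isProbabilityMeasure_weightLaw (hs : 0 ≤ s) (n : ℕ) :
    IsProbabilityMeasure (weightLaw s n) :=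
  isProbabilityMeasure_dirichletLaw (withPrior_one_nonneg hs)

theorem ae_nonneg_weightLaw (hs : 0 ≤ s) (n : ℕ) : ∀ᵐ w ∂weightLaw s n, ∀ i, 0 ≤ w i :=
  ae_nonneg_dirichletLaw (withPrior_one_nonneg hs)

theorem posterior_eq_map (s : ℝ) (Q : Measure (Measure S)) :
    posterior s Q z = ((weightLaw s n).prod Q).map fun p => mixture z p.1 p.2 := rfl

theorem ae_posterior_univ_le_one (hs : 0 ≤ s) {Q : Measure (Measure S)}
    (hQ : ∀ᵐ M ∂Q, IsProbabilityMeasure M) : ∀ᵐ M ∂posterior s Q z, M Set.univ ≤ 1 := by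
  have := isProbabilityMeasure_weightLaw hs n
  rw [posterior_eq_map, ae_map_iff (measurable_mixture z).aemeasurable
    (measurableSet_le (Measure.measurable_coe MeasurableSet.univ) measurable_const)]
  filter_upwards [Measure.quasiMeasurePreserving_fst.ae (ae_nonneg_weightLaw hs n),
    Measure.quasiMeasurePreserving_fst.ae (ae_sum_le_one_dirichletLaw (withPrior s (fun _ => 1) n)),
    Measure.quasiMeasurePreserving_snd.ae hQ] with p hnonneg hsum hM
  rw [mixture_univ z hnonneg]
  exact ENNReal.ofReal_le_one.2 hsum

theorem isProbabilityMeasure_posterior (hs : 0 ≤ s) (Q : Measure (Measure S))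
    [IsProbabilityMeasure Q] : IsProbabilityMeasure (posterior s Q z) := by
  have := isProbabilityMeasure_weightLaw hs n
  exact Measure.isProbabilityMeasure_map (μ := (weightLaw s n).prod Q)
    (measurable_mixture z).aemeasurable

theorem ae_eq_zero_weightLaw_zero (n : ℕ) : ∀ᵐ w ∂weightLaw 0 n, w 0 = 0 := by
  have := fun i => isProbabilityMeasure_gammaLaw (withPrior_one_nonneg (n := n) le_rfl i)
  have hzero : ∀ᵐ x ∂gammaLaw (withPrior 0 (fun _ => 1) n 0), x = 0 := by
    simp [gammaLaw, withPrior]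
  rw [weightLaw, dirichletLaw, ae_map_iff measurable_normalize.aemeasurable
    (measurableSet_eq_fun (by fun_prop) measurable_const)]
  filter_upwards [(Measure.tendsto_eval_ae_ae (i := 0)).eventually hzero] with g hg
  simp_all

theorem posterior_zero_eq_map (Q : Measure (Measure S)) [IsProbabilityMeasure Q] :
    posterior 0 Q z = (weightLaw 0 n).map fun w => mixture z w 0 := by
  have := isProbabilityMeasure_weightLaw le_rfl n
  have hmix : Measurable fun w : Fin (n + 1) → ℝ => mixture z w 0 :=
    (measurable_mixture z).comp (measurable_id.prodMk measurable_const)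
  have hcongr : posterior 0 Q z
      = ((weightLaw 0 n).prod Q).map ((fun w => mixture z w 0) ∘ Prod.fst) := by
    refine Measure.map_congr ?_
    filter_upwards [Measure.quasiMeasurePreserving_fst.ae (ae_eq_zero_weightLaw_zero n)] with p hp
    simp [mixture, hp]
  rw [hcongr, ← Measure.map_map hmix measurable_fst, Measure.map_fst_prod, measure_univ, one_smul]

end Measurability

section PriorMoment

variable {S H H' : Type*} [MeasurableSpace S]
  [NormedAddCommGroup H] [NormedAddCommGroup H'] {φ : S → H} {ψ : S → H'} {M ν : Measure S}
  {Q : Measure (Measure S)}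

/-- A bound for the second moments of the random means of two features that is affine in products
of two integrals, so that domination of the prior controls its expectation. -/
def priorMoment (φ : S → H) (ψ : S → H') (M : Measure S) : ENNReal :=
  (∫⁻ z, ENNReal.ofReal (1 + ‖φ z‖ ^ 2) ∂M) * (∫⁻ z, ENNReal.ofReal (1 + ‖ψ z‖ ^ 2) ∂M)
    + ∫⁻ z, ENNReal.ofReal ((1 + ‖φ z‖ ^ 2) * (1 + ‖ψ z‖ ^ 2)) ∂M

theorem measurable_priorMoment (hφ : Measurable fun z => ‖φ z‖)
    (hψ : Measurable fun z => ‖ψ z‖) : Measurable (priorMoment φ ψ) :=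
  ((Measure.measurable_lintegral (by fun_prop)).mul
    (Measure.measurable_lintegral (by fun_prop))).add (Measure.measurable_lintegral (by fun_prop))

theorem IsDominatedPrior.lintegral_priorMoment_lt_top (hQ : IsDominatedPrior ν Q)
    (hφ : Measurable fun z => ‖φ z‖) (hψ : Measurable fun z => ‖ψ z‖)
    (hν : Integrable (fun z => (1 + ‖φ z‖ ^ 2) * (1 + ‖ψ z‖ ^ 2)) ν) :
    ∫⁻ M, priorMoment φ ψ M ∂Q < ⊤ := by
  let f (z : S) := ENNReal.ofReal (1 + ‖φ z‖ ^ 2)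
  let g (z : S) := ENNReal.ofReal (1 + ‖ψ z‖ ^ 2)
  let F (z : S) := ENNReal.ofReal ((1 + ‖φ z‖ ^ 2) * (1 + ‖ψ z‖ ^ 2))
  have hf : Measurable f := by fun_prop
  have hg : Measurable g := by fun_prop
  have hF : Measurable F := by fun_prop
  have hfg (z : S) : f z * g z = F z := (ENNReal.ofReal_mul (by positivity)).symm
  have one_le_f (z : S) : 1 ≤ f z :=
    ENNReal.one_le_ofReal.2 (le_add_of_nonneg_right (by positivity))
  have one_le_g (z : S) : 1 ≤ g z :=
    ENNReal.one_le_ofReal.2 (le_add_of_nonneg_right (by positivity))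
  have f_le (z : S) : f z ≤ F z := (le_mul_of_one_le_right' (one_le_g z)).trans_eq (hfg z)
  have g_le (z : S) : g z ≤ F z := (le_mul_of_one_le_left' (one_le_f z)).trans_eq (hfg z)
  have I_lt_top : ∫⁻ z, F z ∂ν < ⊤ := hν.lintegral_lt_top
  have product_term : ∫⁻ M, (∫⁻ z, f z ∂M) * (∫⁻ z, g z ∂M) ∂Q < ⊤ := by
    refine (hQ.lintegral_mul_le f g hf hg).trans_lt (ENNReal.add_lt_top.2 ⟨?_, ?_⟩)
    · simpa only [hfg] using I_lt_top
    · exact ENNReal.mul_lt_top ((lintegral_mono f_le).trans_lt I_lt_top)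
        ((lintegral_mono g_le).trans_lt I_lt_top)
  have joint_term : ∫⁻ M, ∫⁻ z, F z ∂M ∂Q < ⊤ := by
    have mass_one : ∀ᵐ M ∂Q, ∫⁻ z, F z ∂M = (∫⁻ z, F z ∂M) * ∫⁻ _, 1 ∂M := by
      filter_upwards [hQ.ae_isProbabilityMeasure] with M hM
      simp
    rw [lintegral_congr_ae mass_one]
    refine (hQ.lintegral_mul_le F _ hF measurable_const).trans_lt (ENNReal.add_lt_top.2 ⟨?_, ?_⟩)
    · simpa only [mul_one] using I_lt_top
    · exact ENNReal.mul_lt_top I_lt_top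
        ((lintegral_mono fun z => (one_le_f z).trans (f_le z)).trans_lt I_lt_top)
  unfold priorMoment
  rw [lintegral_add_right _ (Measure.measurable_lintegral hF)]
  exact ENNReal.add_lt_top.2 ⟨product_term, joint_term⟩

variable [InnerProductSpace ℝ H] [InnerProductSpace ℝ H']

theorem HasMean.ofReal_one_add_norm_sq_le [IsProbabilityMeasure M] {m : H} (hm : HasMean φ M m) :
    ENNReal.ofReal (1 + ‖m‖ ^ 2) ≤ ∫⁻ z, ENNReal.ofReal (1 + ‖φ z‖ ^ 2) ∂M := by
  have hint : Integrable (fun z => 1 - ‖m‖ ^ 2 + 2 * inner ℝ (φ z) m) M :=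
    (integrable_const _).add ((hm.integrable_inner m).const_mul 2)
  have tangent (z : S) : 1 - ‖m‖ ^ 2 + 2 * inner ℝ (φ z) m ≤ 1 + ‖φ z‖ ^ 2 := by
    have := norm_sub_sq_real (φ z) m
    nlinarith [sq_nonneg ‖φ z - m‖]
  have hmean : ∫ z, 1 - ‖m‖ ^ 2 + 2 * inner ℝ (φ z) m ∂M = 1 + ‖m‖ ^ 2 := by
    rw [integral_add (integrable_const _) ((hm.integrable_inner m).const_mul 2),
      integral_const_mul, hm.integral_eq, real_inner_self_eq_norm_sq, integral_const]
    simp only [probReal_univ, one_smul]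
    ring
  rw [← hmean, integral_eq_lintegral_pos_part_sub_lintegral_neg_part hint]
  refine (ENNReal.ofReal_le_ofReal (sub_le_self _ ENNReal.toReal_nonneg)).trans
    (ENNReal.ofReal_toReal_le.trans (lintegral_mono fun z => ENNReal.ofReal_le_ofReal (tangent z)))

/-- The growth in the means `a`, `b`, `u` of a prior component of the effect of that component on
the cross-covariance of a posterior sample. -/
def meanWeight (a : H) (b : H') (u : HilbertTensor H H') : ℝ :=
  (1 + ‖a‖ ^ 2) * (1 + ‖b‖ ^ 2) + ‖u‖ ^ 2

theorem one_add_norm_sq_le_meanWeight (a : H) (b : H') (u : HilbertTensor H H') :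
    1 + ‖u‖ ^ 2 ≤ meanWeight a b u := by
  rw [meanWeight]
  gcongr
  exact one_le_mul_of_one_le_of_one_le (le_add_of_nonneg_right (by positivity))
    (le_add_of_nonneg_right (by positivity))

theorem mul_le_meanWeight (a : H) (b : H') (u : HilbertTensor H H') :
    (1 + ‖a‖ ^ 2) * (1 + ‖b‖ ^ 2) ≤ meanWeight a b u :=
  le_add_of_nonneg_right (by positivity)

theorem HasMeans.ofReal_meanWeight_le [IsProbabilityMeasure M] {a : H} {b : H'}
    {u : HilbertTensor H H'} (h : HasMeans φ ψ M a b u) :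
    ENNReal.ofReal (meanWeight a b u) ≤ priorMoment φ ψ M := by
  rw [meanWeight, ENNReal.ofReal_add (by positivity) (by positivity),
    ENNReal.ofReal_mul (by positivity)]
  refine add_le_add (mul_le_mul' h.left.ofReal_one_add_norm_sq_le h.right.ofReal_one_add_norm_sq_le)
    ((ENNReal.ofReal_le_ofReal (le_add_of_nonneg_left zero_le_one)).trans
      (h.joint.ofReal_one_add_norm_sq_le.trans (lintegral_mono fun z => ?_)))
  refine ENNReal.ofReal_le_ofReal ?_
  rw [norm_pureTensor]
  nlinarith [sq_nonneg ‖φ z‖, sq_nonneg ‖ψ z‖]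

theorem IsFeaturePair.exists_hasMeans_of_priorMoment_lt_top {𝒳 𝒴 : Type*} [MeasurableSpace 𝒳]
    [MeasurableSpace 𝒴] {kX : 𝒳 → 𝒳 → ℝ} {kY : 𝒴 → 𝒴 → ℝ} {φ : 𝒳 × 𝒴 → H} {ψ : 𝒳 × 𝒴 → H'}
    {M : Measure (𝒳 × 𝒴)} [CompleteSpace H] [CompleteSpace H'] (hp : IsFeaturePair kX kY φ ψ)
    (hM : priorMoment φ ψ M < ⊤) : ∃ a b u, HasMeans φ ψ M a b u := by
  have hφ := hp.left.measurable_norm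
  have hψ := hp.right.measurable_norm
  have hF : Integrable (fun z => (1 + ‖φ z‖ ^ 2) * (1 + ‖ψ z‖ ^ 2)) M :=
    ⟨Measurable.aestronglyMeasurable (by fun_prop), (hasFiniteIntegral_iff_ofReal
      (ae_of_all _ fun z => by positivity)).2 (le_add_self.trans_lt hM)⟩
  refine hp.exists_hasMeans (hF.mono' hφ.aestronglyMeasurable (ae_of_all _ fun z => ?_))
    (hF.mono' hψ.aestronglyMeasurable (ae_of_all _ fun z => ?_))
    (hF.mono' hp.joint.measurable_norm.aestronglyMeasurable (ae_of_all _ fun z => ?_))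
  all_goals
    simp only [norm_pureTensor, norm_mul, norm_norm]
    nlinarith [sq_nonneg (‖φ z‖ - 1), sq_nonneg (‖ψ z‖ - 1), sq_nonneg (‖φ z‖ * ‖ψ z‖ - 1),
      sq_nonneg (‖φ z‖ * ‖ψ z‖)]

end PriorMoment

section Perturbation

variable {H H' : Type*} [NormedAddCommGroup H] [InnerProductSpace ℝ H]
  [NormedAddCommGroup H'] [InnerProductSpace ℝ H']

theorem norm_crossCov_sq_le (a : H) (b : H') (u : HilbertTensor H H') :
    ‖crossCov a b u‖ ^ 2 ≤ 2 * (‖u‖ ^ 2 + ‖a‖ ^ 2 * ‖b‖ ^ 2) := by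
  rw [← mul_pow, ← norm_pureTensor]
  exact (pow_le_pow_left₀ (norm_nonneg _) (norm_sub_le _ _) 2).trans add_sq_le

theorem crossCov_sub_crossCov (a a' : H) (b b' : H') (u u' : HilbertTensor H H') :
    crossCov a' b' u' - crossCov a b u
      = u' - u - (pureTensor (a' - a) (b' - b) + pureTensor (a' - a) b
        + pureTensor a (b' - b)) := by
  simp only [crossCov, pureTensor_sub_left, pureTensor_sub_right]
  abel

/-- The bound of `norm_crossCov_sub_sq_le`, a function of the means `a`, `b` and of their
perturbations `δa`, `δb`, `δu`. -/
def perturbationBound (a : H) (b : H') (δa : H) (δb : H') (δu : HilbertTensor H H') : ℝ :=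
  ‖δu‖ ^ 2 + ‖δa‖ ^ 2 * ‖δb‖ ^ 2 + ‖δa‖ ^ 2 * ‖b‖ ^ 2 + ‖a‖ ^ 2 * ‖δb‖ ^ 2

theorem norm_crossCov_sub_sq_le (a a' : H) (b b' : H') (u u' : HilbertTensor H H') :
    ‖crossCov a' b' u' - crossCov a b u‖ ^ 2
      ≤ 4 * perturbationBound a b (a' - a) (b' - b) (u' - u) := by
  have triangle : ‖crossCov a' b' u' - crossCov a b u‖
      ≤ ‖u' - u‖ + ‖a' - a‖ * ‖b' - b‖ + (‖a' - a‖ * ‖b‖ + ‖a‖ * ‖b' - b‖) := by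
    rw [crossCov_sub_crossCov]
    refine (norm_sub_le _ _).trans ((add_le_add_right norm_add₃_le _).trans_eq ?_)
    simp only [norm_pureTensor]
    ring
  refine (pow_le_pow_left₀ (norm_nonneg _) triangle 2).trans (add_sq_le.trans ?_)
  refine (mul_le_mul_of_nonneg_left (add_le_add add_sq_le add_sq_le) zero_le_two).trans_eq ?_
  rw [perturbationBound]
  ring

theorem continuous_crossCov :
    Continuous fun p : H × H' × HilbertTensor H H' => crossCov p.1 p.2.1 p.2.2 := by
  refine continuous_iff_continuousAt.2 fun p => tendsto_iff_norm_sub_tendsto_zero.2 ?_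
  have bound : Tendsto (fun q : H × H' × HilbertTensor H H' =>
      4 * perturbationBound p.1 p.2.1 (q.1 - p.1) (q.2.1 - p.2.1) (q.2.2 - p.2.2)) (𝓝 p) (𝓝 0) := by
    refine Continuous.tendsto' ?_ _ _ ?_
    · unfold perturbationBound
      fun_prop
    · simp [perturbationBound]
  have hsq : Tendsto (fun q : H × H' × HilbertTensor H H' =>
      ‖crossCov q.1 q.2.1 q.2.2 - crossCov p.1 p.2.1 p.2.2‖ ^ 2) (𝓝 p) (𝓝 0) :=
    squeeze_zero (fun q => by positivity) (fun q => norm_crossCov_sub_sq_le _ _ _ _ _ _) bound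
  simpa using hsq.sqrt

theorem abs_norm_sq_sub_norm_sq_le {E : Type*} [SeminormedAddCommGroup E] (x y : E) {t : ℝ}
    (ht : 0 < t) : |‖y‖ ^ 2 - ‖x‖ ^ 2| ≤ t * ‖x‖ ^ 2 + (1 + 1 / t) * ‖y - x‖ ^ 2 := by
  have young : 2 * (‖x‖ * ‖y - x‖) ≤ t * ‖x‖ ^ 2 + 1 / t * ‖y - x‖ ^ 2 := by
    have : 0 ≤ 1 / t * (t * ‖x‖ - ‖y - x‖) ^ 2 := by positivity
    refine sub_nonneg.1 (this.trans_eq ?_)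
    field_simp
    ring
  calc |‖y‖ ^ 2 - ‖x‖ ^ 2| = |‖y‖ - ‖x‖| * (‖y‖ + ‖x‖) := by
        rw [sq_sub_sq, abs_mul, abs_of_nonneg (by positivity), mul_comm]
    _ ≤ ‖y - x‖ * (‖y - x‖ + 2 * ‖x‖) := by
        have : ‖y‖ + ‖x‖ ≤ ‖y - x‖ + 2 * ‖x‖ := by linarith [norm_le_norm_sub_add y x]
        gcongr
        exact abs_norm_sub_norm_le y x
    _ ≤ t * ‖x‖ ^ 2 + (1 + 1 / t) * ‖y - x‖ ^ 2 := by linarith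

end Perturbation

section MixtureCrossCov

variable {H H' : Type*} [NormedAddCommGroup H] [InnerProductSpace ℝ H]
  [NormedAddCommGroup H'] [InnerProductSpace ℝ H'] {s : ℝ} {n : ℕ}
  {x : ℕ → H} {y : ℕ → H'} {a : H} {b : H'} {u : HilbertTensor H H'}

/-- The cross-covariance embedding of a mixture, with weights `w`, of a prior component with means
`a₀`, `b₀`, `u₀` and of a sample with features `x i` and `y i`. -/
def mixtureCrossCov (x : ℕ → H) (y : ℕ → H') (a₀ : H) (b₀ : H') (u₀ : HilbertTensor H H')
    (w : Fin (n + 1) → ℝ) : HilbertTensor H H' :=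
  crossCov (∑ i, w i • withPrior a₀ x n i) (∑ i, w i • withPrior b₀ y n i)
    (∑ i, w i • withPrior u₀ (fun i => pureTensor (x i) (y i)) n i)

theorem continuous_mixtureCrossCov (x : ℕ → H) (y : ℕ → H') (a₀ : H) (b₀ : H')
    (u₀ : HilbertTensor H H') :
    Continuous fun w : Fin (n + 1) → ℝ => mixtureCrossCov x y a₀ b₀ u₀ w :=
  continuous_crossCov.comp (f := fun w : Fin (n + 1) → ℝ => (∑ i, w i • withPrior a₀ x n i,
    ∑ i, w i • withPrior b₀ y n i, ∑ i, w i • withPrior u₀ (fun i => pureTensor (x i) (y i)) n i))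
    (by fun_prop)

theorem exists_norm_sq_sum_smul_withPrior_le (x : ℕ → H) (n : ℕ) :
    ∃ K ≥ 0, ∀ w : Fin (n + 1) → ℝ, (∀ i, 0 ≤ w i) → ∑ i, w i ≤ 1 →
      ∀ x₀ : H, ‖∑ i, w i • withPrior x₀ x n i‖ ^ 2 ≤ K * (1 + ‖x₀‖ ^ 2) := by
  let L := ∑ i ∈ Finset.range n, ‖x i‖
  refine ⟨2 * (1 + L ^ 2), by positivity, fun w hw hw1 x₀ => ?_⟩
  have weight_le_one (i : Fin (n + 1)) : w i ≤ 1 :=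
    (Finset.single_le_sum (fun j _ => hw j) (Finset.mem_univ i)).trans hw1
  have norm_le : ‖∑ i, w i • withPrior x₀ x n i‖ ≤ ‖x₀‖ + L := by
    rw [← sum_withPrior norm]
    exact (norm_sum_smul_withPrior_le hw x₀ x).trans (Finset.sum_le_sum fun i _ =>
      mul_le_of_le_one_left (norm_nonneg _) (weight_le_one i))
  refine (pow_le_pow_left₀ (norm_nonneg _) norm_le 2).trans (add_sq_le.trans ?_)
  nlinarith [mul_nonneg (sq_nonneg ‖x₀‖) (sq_nonneg L)]

theorem exists_norm_sq_mixtureCrossCov_le (x : ℕ → H) (y : ℕ → H') (n : ℕ) :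
    ∃ K ≥ 0, ∀ w : Fin (n + 1) → ℝ, (∀ i, 0 ≤ w i) → ∑ i, w i ≤ 1 → ∀ a₀ b₀ u₀,
      ‖mixtureCrossCov x y a₀ b₀ u₀ w‖ ^ 2 ≤ K * meanWeight a₀ b₀ u₀ := by
  obtain ⟨A, hA0, hA⟩ := exists_norm_sq_sum_smul_withPrior_le x n
  obtain ⟨B, hB0, hB⟩ := exists_norm_sq_sum_smul_withPrior_le y n
  obtain ⟨C, hC0, hC⟩ :=
    exists_norm_sq_sum_smul_withPrior_le (fun i => pureTensor (x i) (y i)) n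
  refine ⟨2 * (C + A * B), by positivity, fun w hw hw1 a₀ b₀ u₀ => ?_⟩
  calc ‖mixtureCrossCov x y a₀ b₀ u₀ w‖ ^ 2
      ≤ 2 * (C * (1 + ‖u₀‖ ^ 2) + A * (1 + ‖a₀‖ ^ 2) * (B * (1 + ‖b₀‖ ^ 2))) := by
        refine (norm_crossCov_sq_le _ _ _).trans ?_
        gcongr
        exacts [hC w hw hw1 u₀, hA w hw hw1 a₀, hB w hw hw1 b₀]
    _ = 2 * (C * (1 + ‖u₀‖ ^ 2) + A * B * ((1 + ‖a₀‖ ^ 2) * (1 + ‖b₀‖ ^ 2))) := by ring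
    _ ≤ 2 * (C * meanWeight a₀ b₀ u₀ + A * B * meanWeight a₀ b₀ u₀) := by
        gcongr
        exacts [one_add_norm_sq_le_meanWeight a₀ b₀ u₀, mul_le_meanWeight a₀ b₀ u₀]
    _ = 2 * (C + A * B) * meanWeight a₀ b₀ u₀ := by ring

/-- The features `x i` and `y i` of a sample have means `a` and `b` and joint mean `u`, in the
sense needed to control the weighted means under the posterior. -/
structure HasSampleMeans (x : ℕ → H) (y : ℕ → H') (a : H) (b : H') (u : HilbertTensor H H') :
    Prop where
  left : IsCentered fun i => x i - a
  right : IsCentered fun i => y i - b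
  joint : IsCentered fun i => pureTensor (x i) (y i) - u

theorem sum_smul_withPrior_sub {w : Fin (n + 1) → ℝ} (hw : ∑ i, w i = 1) (x₀ : H) (x : ℕ → H)
    (m : H) : ∑ i, w i • withPrior x₀ x n i - m
      = ∑ i, w i • withPrior (x₀ - m) (fun i => x i - m) n i := by
  have hsub (i : Fin (n + 1)) :
      withPrior (x₀ - m) (fun i => x i - m) n i = withPrior x₀ x n i - m :=
    Fin.cases rfl (fun _ => rfl) i
  simp_rw [hsub, smul_sub, Finset.sum_sub_distrib, ← Finset.sum_smul, hw, one_smul]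

theorem one_add_norm_sub_sq_le {E : Type*} [SeminormedAddCommGroup E] (x m : E) :
    1 + ‖x - m‖ ^ 2 ≤ 2 * (1 + ‖m‖ ^ 2) * (1 + ‖x‖ ^ 2) := by
  nlinarith [(pow_le_pow_left₀ (norm_nonneg _) (norm_sub_le x m) 2).trans add_sq_le,
    mul_nonneg (sq_nonneg ‖m‖) (sq_nonneg ‖x‖)]

theorem exists_centred_le_meanWeight (a : H) (b : H') (u : HilbertTensor H H') :
    ∃ C > 0, ∀ a₀ b₀ u₀, 1 + ‖u₀ - u‖ ^ 2 + (1 + ‖a₀ - a‖ ^ 2) * (1 + ‖b₀ - b‖ ^ 2)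
        + (1 + ‖a₀ - a‖ ^ 2) * ‖b‖ ^ 2 + ‖a‖ ^ 2 * (1 + ‖b₀ - b‖ ^ 2)
      ≤ C * meanWeight a₀ b₀ u₀ := by
  let α := 2 * (1 + ‖a‖ ^ 2)
  let β := 2 * (1 + ‖b‖ ^ 2)
  let γ := 2 * (1 + ‖u‖ ^ 2)
  have hα : ‖a‖ ^ 2 ≤ α := by simp only [α]; nlinarith [sq_nonneg ‖a‖]
  have hβ : ‖b‖ ^ 2 ≤ β := by simp only [β]; nlinarith [sq_nonneg ‖b‖]
  refine ⟨γ + 3 * (α * β), by positivity, fun a₀ b₀ u₀ => ?_⟩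
  let p := 1 + ‖a₀‖ ^ 2
  let q := 1 + ‖b₀‖ ^ 2
  have hp : 1 ≤ p := le_add_of_nonneg_right (by positivity)
  have hq : 1 ≤ q := le_add_of_nonneg_right (by positivity)
  calc _ ≤ γ * (1 + ‖u₀‖ ^ 2) + α * p * (β * q) + α * p * (β * q) + α * p * (β * q) := by
        gcongr
        · exact one_add_norm_sub_sq_le u₀ u
        · exact one_add_norm_sub_sq_le a₀ a
        · exact one_add_norm_sub_sq_le b₀ b
        · exact one_add_norm_sub_sq_le a₀ a
        · exact hβ.trans (le_mul_of_one_le_right (by positivity) hq)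
        · exact hα.trans (le_mul_of_one_le_right (by positivity) hp)
        · exact one_add_norm_sub_sq_le b₀ b
    _ = γ * (1 + ‖u₀‖ ^ 2) + 3 * (α * β) * (p * q) := by ring
    _ ≤ γ * meanWeight a₀ b₀ u₀ + 3 * (α * β) * meanWeight a₀ b₀ u₀ := by
        gcongr
        exacts [one_add_norm_sq_le_meanWeight a₀ b₀ u₀, mul_le_meanWeight a₀ b₀ u₀]
    _ = (γ + 3 * (α * β)) * meanWeight a₀ b₀ u₀ := by ring

theorem integral_norm_mixtureCrossCov_sub_sq_le (hs : 0 ≤ s) (hn : n ≠ 0) (x : ℕ → H) (y : ℕ → H')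
    (a a₀ : H) (b b₀ : H') (u u₀ : HilbertTensor H H') :
    let δa (w : Fin (n + 1) → ℝ) := ∑ i, w i • withPrior (a₀ - a) (fun i => x i - a) n i
    let δb (w : Fin (n + 1) → ℝ) := ∑ i, w i • withPrior (b₀ - b) (fun i => y i - b) n i
    let δu (w : Fin (n + 1) → ℝ) :=
      ∑ i, w i • withPrior (u₀ - u) (fun i => pureTensor (x i) (y i) - u) n i
    ∫ w, ‖mixtureCrossCov x y a₀ b₀ u₀ w - crossCov a b u‖ ^ 2 ∂weightLaw s n
      ≤ 4 * (∫ w, ‖δu w‖ ^ 2 ∂weightLaw s n + ∫ w, ‖δa w‖ ^ 2 * ‖δb w‖ ^ 2 ∂weightLaw s n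
          + (∫ w, ‖δa w‖ ^ 2 ∂weightLaw s n) * ‖b‖ ^ 2
          + ‖a‖ ^ 2 * ∫ w, ‖δb w‖ ^ 2 ∂weightLaw s n) := by
  intro δa δb δu
  have hcont := continuous_mixtureCrossCov (n := n) x y a₀ b₀ u₀
  have hδa : Continuous δa := by fun_prop
  have hδb : Continuous δb := by fun_prop
  have hδu : Continuous δu := by fun_prop
  have hint {F : (Fin (n + 1) → ℝ) → ℝ} (hF : Continuous F) : Integrable F (weightLaw s n) :=
    integrable_dirichletLaw (withPrior_one_nonneg hs) hF
  have pointwise : ∀ᵐ w ∂weightLaw s n,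
      ‖mixtureCrossCov x y a₀ b₀ u₀ w - crossCov a b u‖ ^ 2
        ≤ 4 * perturbationBound a b (δa w) (δb w) (δu w) := by
    filter_upwards [ae_sum_eq_one_dirichletLaw (withPrior_one_nonneg hs)
      (by rw [sum_withPrior_one]; positivity)] with w hw
    simp only [δa, δb, δu, ← sum_smul_withPrior_sub hw]
    exact norm_crossCov_sub_sq_le _ _ _ _ _ _
  refine (integral_mono_ae (hint (by fun_prop)) (hint (by unfold perturbationBound; fun_prop))
    pointwise).trans_eq ?_
  unfold perturbationBound
  rw [integral_const_mul, integral_add (hint (by fun_prop)) (hint (by fun_prop)),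
    integral_add (hint (by fun_prop)) (hint (by fun_prop)),
    integral_add (hint (by fun_prop)) (hint (by fun_prop)), integral_mul_const, integral_const_mul]

theorem HasSampleMeans.eventually_integral_norm_sub_sq_le (h : HasSampleMeans x y a b u)
    (hs : 0 ≤ s) {ε : ℝ} (hε : 0 < ε) :
    ∀ᶠ n : ℕ in atTop, ∀ a₀ b₀ u₀,
      ∫ w, ‖mixtureCrossCov x y a₀ b₀ u₀ w - crossCov a b u‖ ^ 2 ∂weightLaw s n
        ≤ ε * meanWeight a₀ b₀ u₀ := by
  obtain ⟨C, hC, hweight⟩ := exists_centred_le_meanWeight a b u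
  let δ := ε / (4 * C)
  have hδ : 0 < δ := by positivity
  filter_upwards [h.left.eventually_integral_norm_sq_le hs hδ,
    h.right.eventually_integral_norm_sq_le hs hδ, h.joint.eventually_integral_norm_sq_le hs hδ,
    h.left.eventually_integral_norm_sq_mul_norm_sq_le h.right hs hδ, eventually_ne_atTop 0]
    with n hleft hright hjoint hmixed hn a₀ b₀ u₀
  calc ∫ w, ‖mixtureCrossCov x y a₀ b₀ u₀ w - crossCov a b u‖ ^ 2 ∂weightLaw s n
      ≤ 4 * (δ * (1 + ‖u₀ - u‖ ^ 2) + δ * ((1 + ‖a₀ - a‖ ^ 2) * (1 + ‖b₀ - b‖ ^ 2))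
          + δ * (1 + ‖a₀ - a‖ ^ 2) * ‖b‖ ^ 2 + ‖a‖ ^ 2 * (δ * (1 + ‖b₀ - b‖ ^ 2))) := by
        refine (integral_norm_mixtureCrossCov_sub_sq_le hs hn x y a a₀ b b₀ u u₀).trans ?_
        gcongr
        exacts [hjoint _, hmixed _ _, hleft _, hright _]
    _ = 4 * δ * (1 + ‖u₀ - u‖ ^ 2 + (1 + ‖a₀ - a‖ ^ 2) * (1 + ‖b₀ - b‖ ^ 2)
          + (1 + ‖a₀ - a‖ ^ 2) * ‖b‖ ^ 2 + ‖a‖ ^ 2 * (1 + ‖b₀ - b‖ ^ 2)) := by ring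
    _ ≤ 4 * δ * (C * meanWeight a₀ b₀ u₀) := by
        gcongr
        exact hweight a₀ b₀ u₀
    _ = ε * meanWeight a₀ b₀ u₀ := by
        simp only [δ]
        field_simp

theorem HasSampleMeans.eventually_lintegral_enorm_le (h : HasSampleMeans x y a b u)
    (hs : 0 ≤ s) {ε : ℝ} (hε : 0 < ε) :
    ∀ᶠ n : ℕ in atTop, ∀ a₀ b₀ u₀,
      ∫⁻ w, ‖‖mixtureCrossCov x y a₀ b₀ u₀ w‖ ^ 2 - ‖crossCov a b u‖ ^ 2‖ₑ ∂weightLaw s n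
        ≤ ENNReal.ofReal (ε * meanWeight a₀ b₀ u₀) := by
  let V := ‖crossCov a b u‖ ^ 2
  let t := ε / (2 * (V + 1))
  have ht : 0 < t := by positivity
  filter_upwards [h.eventually_integral_norm_sub_sq_le hs
    (show 0 < ε / (2 * (1 + 1 / t)) by positivity)] with n hn a₀ b₀ u₀
  have := isProbabilityMeasure_dirichletLaw (withPrior_one_nonneg (n := n) hs)
  have hcont := continuous_mixtureCrossCov (n := n) x y a₀ b₀ u₀
  have hint {F : (Fin (n + 1) → ℝ) → ℝ} (hF : Continuous F) : Integrable F (weightLaw s n) :=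
    integrable_dirichletLaw (withPrior_one_nonneg hs) hF
  have one_le : 1 ≤ meanWeight a₀ b₀ u₀ :=
    (le_add_of_nonneg_right (sq_nonneg ‖u₀‖)).trans (one_add_norm_sq_le_meanWeight a₀ b₀ u₀)
  have tV_le : t * V ≤ ε / 2 := by
    rw [div_mul_eq_mul_div, ← div_div, div_le_iff₀ (by positivity)]
    nlinarith
  rw [← ofReal_integral_norm_eq_lintegral_enorm (hint (by fun_prop))]
  refine ENNReal.ofReal_le_ofReal ?_
  simp_rw [Real.norm_eq_abs]
  calc ∫ w, |‖mixtureCrossCov x y a₀ b₀ u₀ w‖ ^ 2 - V| ∂weightLaw s n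
      ≤ ∫ w, (t * V + (1 + 1 / t)
          * ‖mixtureCrossCov x y a₀ b₀ u₀ w - crossCov a b u‖ ^ 2) ∂weightLaw s n :=
        integral_mono (hint (by fun_prop)) (hint (by fun_prop))
          fun w => abs_norm_sq_sub_norm_sq_le _ _ ht
    _ = t * V + (1 + 1 / t)
          * ∫ w, ‖mixtureCrossCov x y a₀ b₀ u₀ w - crossCov a b u‖ ^ 2 ∂weightLaw s n := by
        rw [integral_add (integrable_const _) (hint (by fun_prop)), integral_const,
          probReal_univ, one_smul, integral_const_mul]
    _ ≤ ε / 2 * meanWeight a₀ b₀ u₀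
          + (1 + 1 / t) * (ε / (2 * (1 + 1 / t)) * meanWeight a₀ b₀ u₀) := by
        refine add_le_add (tV_le.trans (le_mul_of_one_le_right (by positivity) one_le)) ?_
        gcongr
        exact hn a₀ b₀ u₀
    _ = ε * meanWeight a₀ b₀ u₀ := by
        field_simp
        ring

end MixtureCrossCov

section Posterior

variable {𝒳 𝒴 H H' : Type*} [MeasurableSpace 𝒳] [MeasurableSpace 𝒴]
  [NormedAddCommGroup H] [InnerProductSpace ℝ H] [NormedAddCommGroup H'] [InnerProductSpace ℝ H']
  {kX : 𝒳 → 𝒳 → ℝ} {kY : 𝒴 → 𝒴 → ℝ} {φ : 𝒳 × 𝒴 → H} {ψ : 𝒳 × 𝒴 → H'} {s : ℝ}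
  {ν : Measure (𝒳 × 𝒴)} {Q : Measure (Measure (𝒳 × 𝒴))} {z : ℕ → 𝒳 × 𝒴}

namespace IsFeaturePair

theorem hsic_mixture (hp : IsFeaturePair kX kY φ ψ) (z : ℕ → 𝒳 × 𝒴) {n : ℕ}
    {w : Fin (n + 1) → ℝ} (hw : ∀ i, 0 ≤ w i) {M : Measure (𝒳 × 𝒴)} [SFinite M] {a₀ : H}
    {b₀ : H'} {u₀ : HilbertTensor H H'} (h : HasMeans φ ψ M a₀ b₀ u₀) :
    hsic kX kY (mixture (fun i : Fin n => z i) w M)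
      = ‖mixtureCrossCov (fun i => φ (z i)) (fun i => ψ (z i)) a₀ b₀ u₀ w‖ ^ 2 := by
  have : SFinite (mixture (fun i : Fin n => z i) w M) := by
    rw [mixture, ← Measure.sum_fintype]
    infer_instance
  have means : HasMeans φ ψ (mixture (fun i : Fin n => z i) w M) _ _ _ :=
    ⟨hp.left.hasMean_mixture _ hw h.left, hp.right.hasMean_mixture _ hw h.right,
      hp.joint.hasMean_mixture _ hw h.joint⟩
  rw [hp.hsic_eq_norm_sq means, mixtureCrossCov]
  simp only [Fin.sum_univ_succ, withPrior, Fin.cons_zero, Fin.cons_succ]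

variable [CompleteSpace H] [CompleteSpace H']

theorem lintegral_posterior_enorm_hsic_sub_le (hp : IsFeaturePair kX kY φ ψ) (hs : 0 ≤ s)
    [SFinite Q] (hQ : ∀ᵐ M ∂Q, IsProbabilityMeasure M) (hfin : ∫⁻ M, priorMoment φ ψ M ∂Q < ⊤)
    {n : ℕ} {c K : ℝ} (hK : 0 ≤ K)
    (hmix : ∀ a₀ b₀ u₀,
      ∫⁻ w, ‖‖mixtureCrossCov (fun i => φ (z i)) (fun i => ψ (z i)) a₀ b₀ u₀ w‖ ^ 2 - c‖ₑ
        ∂weightLaw s n ≤ ENNReal.ofReal (K * meanWeight a₀ b₀ u₀)) :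
    ∫⁻ M, ‖hsic kX kY M - c‖ₑ ∂posterior s Q (fun i : Fin n => z i)
      ≤ ENNReal.ofReal K * ∫⁻ M, priorMoment φ ψ M ∂Q := by
  have := isProbabilityMeasure_weightLaw hs n
  have hmeas : AEMeasurable (fun M => ‖hsic kX kY M - c‖ₑ) (posterior s Q fun i : Fin n => z i) :=
    ((aestronglyMeasurable_hsic hp.measurable_kernel_left hp.measurable_kernel_right
      (ae_posterior_univ_le_one _ hs hQ)).sub aestronglyMeasurable_const).enorm
  have hmoment := measurable_priorMoment hp.left.measurable_norm hp.right.measurable_norm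
  rw [posterior_eq_map] at hmeas ⊢
  have hmixture := (measurable_mixture fun i : Fin n => z i).aemeasurable
    (μ := (weightLaw s n).prod Q)
  have hcomp : AEMeasurable
      (fun p => ‖hsic kX kY (mixture (fun i : Fin n => z i) p.1 p.2) - c‖ₑ)
      ((weightLaw s n).prod Q) := hmeas.comp_aemeasurable hmixture
  rw [lintegral_map' hmeas hmixture, lintegral_prod_symm _ hcomp,
    ← lintegral_const_mul _ hmoment]
  refine lintegral_mono_ae ?_
  filter_upwards [hQ, ae_lt_top hmoment hfin.ne] with M hM hMfin
  obtain ⟨a₀, b₀, u₀, h⟩ := hp.exists_hasMeans_of_priorMoment_lt_top hMfin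
  calc ∫⁻ w, ‖hsic kX kY (mixture (fun i : Fin n => z i) w M) - c‖ₑ ∂weightLaw s n
      = ∫⁻ w, ‖‖mixtureCrossCov (fun i => φ (z i)) (fun i => ψ (z i)) a₀ b₀ u₀ w‖ ^ 2 - c‖ₑ
          ∂weightLaw s n := by
        refine lintegral_congr_ae ?_
        filter_upwards [ae_nonneg_weightLaw hs n] with w hw
        rw [hp.hsic_mixture z hw h]
    _ ≤ ENNReal.ofReal K * ENNReal.ofReal (meanWeight a₀ b₀ u₀) := by
        rw [← ENNReal.ofReal_mul hK]
        exact hmix a₀ b₀ u₀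
    _ ≤ ENNReal.ofReal K * priorMoment φ ψ M := by
        gcongr
        exact h.ofReal_meanWeight_le

theorem integrable_hsic_posterior (hp : IsFeaturePair kX kY φ ψ) (hs : 0 ≤ s)
    [SFinite Q] (hQ : ∀ᵐ M ∂Q, IsProbabilityMeasure M) (hfin : ∫⁻ M, priorMoment φ ψ M ∂Q < ⊤)
    (z : ℕ → 𝒳 × 𝒴) (n : ℕ) :
    Integrable (hsic kX kY) (posterior s Q fun i : Fin n => z i) := by
  have := isProbabilityMeasure_weightLaw hs n
  obtain ⟨K, hK, hbound⟩ :=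
    exists_norm_sq_mixtureCrossCov_le (fun i => φ (z i)) (fun i => ψ (z i)) n
  refine ⟨aestronglyMeasurable_hsic hp.measurable_kernel_left hp.measurable_kernel_right
    (ae_posterior_univ_le_one _ hs hQ), ?_⟩
  refine (lintegral_mono fun M => by rw [sub_zero]).trans_lt
    ((hp.lintegral_posterior_enorm_hsic_sub_le hs hQ hfin (c := 0) hK fun a₀ b₀ u₀ => ?_).trans_lt
      (ENNReal.mul_lt_top ENNReal.ofReal_lt_top hfin))
  refine (lintegral_mono_ae (g := fun _ => ENNReal.ofReal (K * meanWeight a₀ b₀ u₀)) ?_).trans ?_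
  · filter_upwards [ae_nonneg_weightLaw hs n, ae_sum_le_one_dirichletLaw _] with w hw hw1
    rw [sub_zero, Real.enorm_of_nonneg (by positivity)]
    exact ENNReal.ofReal_le_ofReal (hbound w hw hw1 a₀ b₀ u₀)
  · simp

theorem tendsto_lintegral_posterior_enorm_hsic_sub (hp : IsFeaturePair kX kY φ ψ) (hs : 0 ≤ s)
    [SFinite Q] (hQ : ∀ᵐ M ∂Q, IsProbabilityMeasure M) (hfin : ∫⁻ M, priorMoment φ ψ M ∂Q < ⊤)
    {a : H} {b : H'} {u : HilbertTensor H H'}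
    (hz : HasSampleMeans (fun i => φ (z i)) (fun i => ψ (z i)) a b u) :
    Tendsto (fun n : ℕ => ∫⁻ M, ‖hsic kX kY M - ‖crossCov a b u‖ ^ 2‖ₑ
      ∂(posterior s Q fun i : Fin n => z i)) atTop (𝓝 0) := by
  refine ENNReal.tendsto_nhds_zero.2 fun ε hε => ?_
  obtain ⟨δ, hδ, hδε⟩ := ENNReal.exists_nnreal_pos_mul_lt hfin.ne hε.ne'
  filter_upwards [hz.eventually_lintegral_enorm_le hs hδ] with n hn
  exact (hp.lintegral_posterior_enorm_hsic_sub_le hs hQ hfin δ.coe_nonneg hn).trans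
    (by rw [ENNReal.ofReal_coe_nnreal]; exact hδε.le)

end IsFeaturePair

theorem IsCentered.tendsto_average_fin {E : Type*} [NormedAddCommGroup E] [InnerProductSpace ℝ E]
    {x : ℕ → E} {m : E} (h : IsCentered fun i => x i - m) :
    Tendsto (fun n : ℕ => (n : ℝ)⁻¹ • ∑ i : Fin n, x i) atTop (𝓝 m) := by
  have hlim := h.tendsto_average.add_const m
  rw [zero_add] at hlim
  refine hlim.congr' ?_
  filter_upwards [eventually_ne_atTop 0] with n hn
  have hn' : (n : ℝ) ≠ 0 := by exact_mod_cast hn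
  rw [Finset.sum_sub_distrib, Finset.sum_const, Finset.card_range, smul_sub,
    ← Nat.cast_smul_eq_nsmul ℝ, inv_smul_smul₀ hn', sub_add_cancel, Finset.sum_range]

theorem IsFeaturePair.tendsto_hsicObs (hp : IsFeaturePair kX kY φ ψ)
    {a : H} {b : H'} {u : HilbertTensor H H'}
    (hz : HasSampleMeans (fun i => φ (z i)) (fun i => ψ (z i)) a b u) :
    Tendsto (fun n : ℕ => hsicObs kX kY fun i : Fin n => z i) atTop
      (𝓝 (‖crossCov a b u‖ ^ 2)) := by
  simp_rw [hp.hsicObs_eq_norm_sq]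
  exact (((continuous_crossCov.tendsto (a, b, u)).comp (hz.left.tendsto_average_fin.prodMk_nhds
    (hz.right.tendsto_average_fin.prodMk_nhds hz.joint.tendsto_average_fin))).norm).pow 2

end Posterior

section Consistency

section MeanConvergence

variable {S : Type*} [MeasurableSpace S] {ρ : ℕ → Measure S} [∀ n, IsProbabilityMeasure (ρ n)]
  {h : S → ℝ} {c : ℝ}

theorem tendsto_integral_of_tendsto_lintegral_enorm_sub (hint : ∀ n, Integrable h (ρ n))
    (hlim : Tendsto (fun n => ∫⁻ z, ‖h z - c‖ₑ ∂ρ n) atTop (𝓝 0)) :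
    Tendsto (fun n => ∫ z, h z ∂ρ n) atTop (𝓝 c) := by
  rw [tendsto_iff_edist_tendsto_0]
  refine tendsto_of_tendsto_of_tendsto_of_le_of_le tendsto_const_nhds hlim
    (fun _ => zero_le) fun n => ?_
  calc edist (∫ z, h z ∂ρ n) c = ‖∫ z, (h z - c) ∂ρ n‖ₑ := by
        rw [integral_sub (hint n) (integrable_const c), integral_const, probReal_univ, one_smul,
          edist_eq_enorm_sub]
    _ ≤ ∫⁻ z, ‖h z - c‖ₑ ∂ρ n := enorm_integral_le_lintegral_enorm _

theorem tendsto_measure_of_tendsto_lintegral_enorm_sub (hint : ∀ n, Integrable h (ρ n))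
    (hlim : Tendsto (fun n => ∫⁻ z, ‖h z - c‖ₑ ∂ρ n) atTop (𝓝 0)) {ε : ℝ} (hε : 0 < ε) :
    Tendsto (fun n => ρ n {z | ε ≤ |h z - c|}) atTop (𝓝 0) := by
  have hε' : ENNReal.ofReal ε ≠ 0 := (ENNReal.ofReal_pos.2 hε).ne'
  have hdiv := ENNReal.Tendsto.div_const hlim (Or.inr hε')
  rw [ENNReal.zero_div] at hdiv
  refine tendsto_of_tendsto_of_tendsto_of_le_of_le tendsto_const_nhds hdiv
    (fun _ => zero_le) fun n => ?_
  calc ρ n {z | ε ≤ |h z - c|} ≤ ρ n {z | ENNReal.ofReal ε ≤ ‖h z - c‖ₑ} := by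
        refine measure_mono fun z hz => ?_
        rw [Set.mem_ofPred_eq, Real.enorm_eq_ofReal_abs]
        exact ENNReal.ofReal_le_ofReal hz
    _ ≤ (∫⁻ z, ‖h z - c‖ₑ ∂ρ n) / ENNReal.ofReal ε :=
        meas_ge_le_lintegral_div ((hint n).sub (integrable_const c)).aestronglyMeasurable.enorm
          hε' ENNReal.ofReal_ne_top

end MeanConvergence

theorem exists_isDominatedPrior_posterior_eq {S : Type*} [MeasurableSpace S] {s : ℝ} (hs : 0 ≤ s)
    {ν : Measure S} [IsProbabilityMeasure ν] {Q : Measure (Measure S)} [IsProbabilityMeasure Q]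
    (hQ : 0 < s → IsDominatedPrior ν Q) :
    ∃ Q' : Measure (Measure S), IsProbabilityMeasure Q' ∧ IsDominatedPrior ν Q' ∧
      ∀ (n : ℕ) (z : Fin n → S), posterior s Q z = posterior s Q' z := by
  rcases hs.eq_or_lt with rfl | hpos
  · exact ⟨Measure.dirac ν, inferInstance, isDominatedPrior_dirac ν, fun n z => by
      rw [posterior_zero_eq_map, posterior_zero_eq_map]⟩
  · exact ⟨Q, inferInstance, hQ hpos, fun n z => rfl⟩

variable {Ω 𝒳 𝒴 H H' : Type*} [MeasurableSpace Ω] [MeasurableSpace 𝒳] [MeasurableSpace 𝒴]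
  [NormedAddCommGroup H] [InnerProductSpace ℝ H] [NormedAddCommGroup H'] [InnerProductSpace ℝ H']
  {kX : 𝒳 → 𝒳 → ℝ} {kY : 𝒴 → 𝒴 → ℝ} {φ : 𝒳 × 𝒴 → H} {ψ : 𝒳 × 𝒴 → H'}

theorem IsFeaturePair.integrable_one_add_norm_sq_mul (hp : IsFeaturePair kX kY φ ψ)
    {ν : Measure (𝒳 × 𝒴)} [IsFiniteMeasure ν]
    (hX : Integrable (fun z => kX z.1 z.1) ν) (hY : Integrable (fun z => kY z.2 z.2) ν)
    (hXY : Integrable (fun z => kX z.1 z.1 * kY z.2 z.2) ν) :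
    Integrable (fun z => (1 + ‖φ z‖ ^ 2) * (1 + ‖ψ z‖ ^ 2)) ν := by
  simp_rw [← real_inner_self_eq_norm_sq, hp.inner_left, hp.inner_right, add_mul, mul_add, one_mul,
    mul_one]
  exact ((integrable_const 1).add hY).add (hX.add hXY)

theorem IsFeaturePair.ae_hasSampleMeans [CompleteSpace H] [CompleteSpace H']
    (hp : IsFeaturePair kX kY φ ψ) {μ : Measure Ω} {P : Measure (𝒳 × 𝒴)} [IsProbabilityMeasure P]
    {Z : ℕ → Ω → 𝒳 × 𝒴} (hlaw : ∀ i, HasLaw (Z i) P μ)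
    (hindep : Pairwise fun i j => IndepFun (Z i) (Z j) μ)
    {a : H} {b : H'} {u : HilbertTensor H H'} (h : HasMeans φ ψ P a b u) :
    ∀ᵐ ω ∂μ, HasSampleMeans (fun i => φ (Z i ω)) (fun i => ψ (Z i ω)) a b u := by
  filter_upwards [h.left.ae_isCentered hp.left hlaw hindep,
    h.right.ae_isCentered hp.right hlaw hindep, h.joint.ae_isCentered hp.joint hlaw hindep]
    with ω hleft hright hjoint
  exact ⟨hleft, hright, hjoint⟩

end Consistency

end BayesHSIC

end

open BayesHSIC in
theorem mainTheorem2_general {Ω 𝒳 𝒴 : Type*} [MeasurableSpace Ω] [MeasurableSpace 𝒳]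
    [MeasurableSpace 𝒴] {kX : 𝒳 → 𝒳 → ℝ} {kY : 𝒴 → 𝒴 → ℝ}
    (hkX : IsMeasurableKernel kX) (hkY : IsMeasurableKernel kY)
    {μ : Measure Ω} {P : Measure (𝒳 × 𝒴)} [IsProbabilityMeasure P] {Z : ℕ → Ω → 𝒳 × 𝒴}
    (hlaw : ∀ i, HasLaw (Z i) P μ) (hindep : Pairwise fun i j => IndepFun (Z i) (Z j) μ)
    (hPX : Integrable (fun z => √(kX z.1 z.1)) P) (hPY : Integrable (fun z => √(kY z.2 z.2)) P)
    (hPXY : Integrable (fun z => √(kX z.1 z.1 * kY z.2 z.2)) P)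
    {s : ℝ} (hs : 0 ≤ s) {ν : Measure (𝒳 × 𝒴)} [IsProbabilityMeasure ν]
    (hνX : Integrable (fun z => kX z.1 z.1) ν) (hνY : Integrable (fun z => kY z.2 z.2) ν)
    (hνXY : Integrable (fun z => kX z.1 z.1 * kY z.2 z.2) ν)
    {Q : Measure (Measure (𝒳 × 𝒴))} [IsProbabilityMeasure Q]
    (hQ : 0 < s → IsDominatedPrior ν Q) :
    ∀ᵐ ω ∂μ,
      (∀ n : ℕ, Integrable (hsic kX kY) (posterior s Q fun i : Fin n => Z i ω)) ∧
      Tendsto (fun n : ℕ => hsicObs kX kY fun i : Fin n => Z i ω) atTop (𝓝 (hsic kX kY P)) ∧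
      Tendsto (fun n : ℕ => ∫ M, hsic kX kY M ∂(posterior s Q fun i : Fin n => Z i ω))
        atTop (𝓝 (hsic kX kY P)) ∧
      ∀ ε : ℝ, 0 < ε →
        Tendsto (fun n : ℕ => posterior s Q (fun i : Fin n => Z i ω)
            {M | ε ≤ |hsic kX kY M - hsic kX kY P|}) atTop (𝓝 0) := by
  obtain ⟨Q', _, hQ', hposterior⟩ := exists_isDominatedPrior_posterior_eq hs hQ
  simp_rw [hposterior]
  obtain ⟨H, _, _, _, H', _, _, _, φ, ψ, hp⟩ := exists_isFeaturePair hkX hkY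
  simp_rw [← hp.norm_left] at hPX
  simp_rw [← hp.norm_right] at hPY
  simp_rw [← hp.norm_joint] at hPXY
  obtain ⟨a, b, u, hmeans⟩ := hp.exists_hasMeans hPX hPY hPXY
  rw [hp.hsic_eq_norm_sq hmeans]
  have hmoment := hQ'.lintegral_priorMoment_lt_top hp.left.measurable_norm
    hp.right.measurable_norm (hp.integrable_one_add_norm_sq_mul hνX hνY hνXY)
  filter_upwards [hp.ae_hasSampleMeans hlaw hindep hmeans] with ω hω
  have hprob (n : ℕ) := isProbabilityMeasure_posterior (fun i : Fin n => Z i ω) hs Q'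
  have hint := hp.integrable_hsic_posterior hs hQ'.ae_isProbabilityMeasure hmoment fun i => Z i ω
  have hlim := hp.tendsto_lintegral_posterior_enorm_hsic_sub hs hQ'.ae_isProbabilityMeasure
    hmoment (z := fun i => Z i ω) hω
  exact ⟨hint, hp.tendsto_hsicObs (z := fun i => Z i ω) hω,
    tendsto_integral_of_tendsto_lintegral_enorm_sub hint hlim,
    fun ε hε => tendsto_measure_of_tendsto_lintegral_enorm_sub hint hlim hε⟩

open BayesHSIC in
theorem mainTheorem2 {Ω 𝒳 𝒴 : Type*} [MeasurableSpace Ω] [MeasurableSpace 𝒳] [MeasurableSpace 𝒴]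
    -- kernels on the two domains
    (kX : 𝒳 → 𝒳 → ℝ) (kY : 𝒴 → 𝒴 → ℝ)
    (hkX : BayesHSIC.IsMeasurableKernel kX) (hkY : BayesHSIC.IsMeasurableKernel kY)
    -- an i.i.d. sample from `P`, whose kernel mean embeddings exist
    (μ : Measure Ω) [IsProbabilityMeasure μ]
    (P : Measure (𝒳 × 𝒴)) [IsProbabilityMeasure P]
    (Z : ℕ → Ω → 𝒳 × 𝒴) (hlaw : ∀ i, HasLaw (Z i) P μ) (hindep : iIndepFun Z μ)
    (hPX : Integrable (fun z : 𝒳 × 𝒴 => √(kX z.1 z.1)) P)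
    (hPY : Integrable (fun z : 𝒳 × 𝒴 => √(kY z.2 z.2)) P)
    (hPXY : Integrable (fun z : 𝒳 × 𝒴 => √(kX z.1 z.1 * kY z.2 z.2)) P)
    -- the prior `Dp(s, ν)`; the limiting case `s = 0` (no prior component) is included
    (s : ℝ) (hs : 0 ≤ s) (ν : Measure (𝒳 × 𝒴)) [IsProbabilityMeasure ν]
    (hνX : Integrable (fun z : 𝒳 × 𝒴 => kX z.1 z.1) ν)
    (hνY : Integrable (fun z : 𝒳 × 𝒴 => kY z.2 z.2) ν)
    (hνXY : Integrable (fun z : 𝒳 × 𝒴 => kX z.1 z.1 * kY z.2 z.2) ν)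
    (Q : Measure (Measure (𝒳 × 𝒴))) [IsProbabilityMeasure Q]
    (hQ : 0 < s → BayesHSIC.IsDirichletProcess (ENNReal.ofReal s • ν) Q) :
    ∀ᵐ ω ∂μ,
      -- the posterior mean exists for every sample size
      (∀ n : ℕ, Integrable (BayesHSIC.hsic kX kY)
        (BayesHSIC.posterior s Q fun i : Fin n => Z i ω)) ∧
      -- the classical empirical estimate converges to the population value
      Tendsto (fun n : ℕ => BayesHSIC.hsicObs kX kY fun i : Fin n => Z i ω)
        atTop (𝓝 (BayesHSIC.hsic kX kY P)) ∧
      -- the posterior mean converges to the same limit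
      Tendsto (fun n : ℕ => ∫ M, BayesHSIC.hsic kX kY M
          ∂(BayesHSIC.posterior s Q fun i : Fin n => Z i ω))
        atTop (𝓝 (BayesHSIC.hsic kX kY P)) ∧
      -- consistency: the posterior of the criterion concentrates at the population value
      ∀ ε : ℝ, 0 < ε →
        Tendsto (fun n : ℕ => BayesHSIC.posterior s Q (fun i : Fin n => Z i ω)
            {M | ε ≤ |BayesHSIC.hsic kX kY M - BayesHSIC.hsic kX kY P|})
          atTop (𝓝 0) :=
  mainTheorem2_general hkX hkY hlaw (fun _ _ h => hindep.indepFun h) hPX hPY hPXY hs hνX hνY hνXY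
    fun h => IsDirichletProcess.isDominatedPrior h (hQ h)
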